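/- Let $N\ge 0$, $\Xi=\mathbb R^N\times(\mathbb R^N)^*$ with Lebesgue measure, with points $X=(x,\xi)$, $Y=(y,\eta)$, $Z=(z,\zeta)$ and symplectic form $\sigma(X,Y)=y\cdot\xi-x\cdot\eta$. Let $B=\sum_{j<k}B_{jk}\,dx_j\wedge dx_k$ ($B_{jk}=-B_{kj}$ real) be a 2-form on $\mathbb R^N$ with continuous components, closed in the sense of distributions, and let $\Gamma^B(\langle a,b,c\rangle)$ be its flux through the oriented triangle with vertices $a,b,c$. Put $\mathfrak e_X(Z)=e^{-i\sigma(X,Z)}$. The magnetic product is $$(f\#^Bg)(X)=\pi^{-2N}\int_\Xi\int_\Xi e^{-2i\sigma(X-Y,X-Z)}\,e^{-i\Gamma^B(\langle x-y+z,\;y-z+x,\;z-x+y\rangle)}f(Y)g(Z)\,dY\,dZ ,$$ for $f,g\in L^1(\Xi)$; for $f,g\in L^2(\Xi)$, or if one of the factors is in $L^2(\Xi)$ and the other is some $\mathfrak e_X$, $f\#^Bg\in L^2(\Xi)$ is the limit in $L^2(\Xi)$, as $\varepsilon\downarrow0$, of $(\chi_\varepsilon f)\#^B(\chi_\varepsilon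 g)$, where $\chi_\varepsilon(X)=e^{-\varepsilon(|x|^2+|\xi|^2)}$. Write $\langle f,g\rangle=\int_\Xi fg$ and $\langle\!\langle F,G\rangle\!\rangle=\int_\Xi\int_\Xi F(X,Y)G(X,Y)\,dX\,dY$ (bilinear pairings), and for $f,h\in L^2(\Xi)$ define $$[M^B_h(f)](X,Y)=\big\langle (\mathfrak e_{-X}\#^Bf)\#^B\mathfrak e_{X-Y},\,h\big\rangle .$$ Then for all $f\in L^2(\Xi)$, $X,Y\in\Xi$, the products $\mathfrak e_{-X}\#^Bf$ and $(\mathfrak e_{-X}\#^Bf)\#^B\mathfrak e_{X-Y}$ exist in $L^2(\Xi)$; $M^B_h(f)\in L^2(\Xi\times\Xi)$ for all $f,h\in L^2(\Xi)$; and for all $f,g,h,k\in L^2(\Xi)$ $$\big\langle\!\big\langle\overline{M^B_h(f)},M^B_k(g)\big\rangle\!\big\rangle=(2\pi)^{2N}\,\langle\overline h,k\rangle\,\langle\overline f,g\rangle .$$ In particular, for $h\neq0$, $\dfrac{1}{(2\pi)^{N}\|h\|}M^B_h$ is a linear isometry from $L^2(\Xi)$ into $L^2(\Xi\times\Xi)$.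 -/

import Mathlib

open MeasureTheory Filter Topology
open scoped ContDiff ComplexConjugate

noncomputable section

/-- The configuration space `ℝ^N`, also used for its dual via the Euclidean pairing. -/
abbrev ConfSpace (N : ℕ) : Type := EuclideanSpace ℝ (Fin N)

/-- The phase space `Ξ = ℝ^N × (ℝ^N)^*`, with points `X = (x, ξ)` and Lebesgue measure. -/
abbrev PhaseSpace (N : ℕ) : Type := ConfSpace N × ConfSpace N

/-- A magnetic field: a continuous 2-form `B = ∑_{j<k} B_jk dx_j ∧ dx_k` on `ℝ^N` which is
closed. As the components are only continuous, `dB = 0` is meant in the sense of distributions. -/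
structure MagneticField (N : ℕ) where
  /-- the components `B_jk` -/
  comp : Fin N → Fin N → ConfSpace N → ℝ
  continuous_comp : ∀ j k, Continuous (comp j k)
  antisymm : ∀ j k x, comp j k x = -comp k j x
  closed : ∀ j k l, ∀ φ : ConfSpace N → ℝ, ContDiff ℝ ∞ φ → HasCompactSupport φ →
    ∫ x, (comp j k x * fderiv ℝ φ x (EuclideanSpace.single l 1)
      + comp k l x * fderiv ℝ φ x (EuclideanSpace.single j 1)
      + comp l j x * fderiv ℝ φ x (EuclideanSpace.single k 1)) = 0

/-- The flux of `B` through the oriented triangle `<a, b, c>`, i.e. the integral of the pullback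
of the 2-form along `(s, t) ↦ a + s (b - a) + t (c - a)` over `{s, t ≥ 0, s + t ≤ 1}`. -/
def MagneticField.flux {N : ℕ} (B : MagneticField N) (a b c : ConfSpace N) : ℝ :=
  ∫ s in (0 : ℝ)..1, ∫ t in (0 : ℝ)..(1 - s),
    ∑ j, ∑ k, B.comp j k (a + s • (b - a) + t • (c - a)) * ((b - a) j * (c - a) k)

/-- The symplectic form `σ((x, ξ), (y, η)) = y · ξ - x · η`. -/
def sympl {N : ℕ} (X Y : PhaseSpace N) : ℝ :=
  inner ℝ Y.1 X.2 - inner ℝ X.1 Y.2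

/-- The exponentials `𝔢_X(Z) = exp(-i σ(X, Z))`. -/
def phaseExp {N : ℕ} (X Z : PhaseSpace N) : ℂ :=
  Complex.exp (-Complex.I * (sympl X Z : ℂ))

/-- The integral formula of the magnetic Weyl composition law; it converges absolutely for
integrable `f` and `g`. -/
def magneticIntegral {N : ℕ} (B : MagneticField N) (f g : PhaseSpace N → ℂ)
    (X : PhaseSpace N) : ℂ :=
  ((Real.pi : ℂ) ^ (2 * N))⁻¹ * ∫ Y : PhaseSpace N, ∫ Z : PhaseSpace N,
    Complex.exp (-2 * Complex.I * (sympl (X - Y) (X - Z) : ℂ)) *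
      Complex.exp (-Complex.I *
        (B.flux (X.1 - Y.1 + Z.1) (Y.1 - Z.1 + X.1) (Z.1 - X.1 + Y.1) : ℂ)) *
      f Y * g Z

/-- Gaussian cut-off `(χ_ε f)(X) = exp(-ε (|x|² + |ξ|²)) f(X)`. -/
def gaussCutoff {N : ℕ} (ε : ℝ) (f : PhaseSpace N → ℂ) (X : PhaseSpace N) : ℂ :=
  (Real.exp (-ε * (‖X.1‖ ^ 2 + ‖X.2‖ ^ 2)) : ℂ) * f X

/-- `p ∈ L²(Ξ)` is the magnetic product `f #^B g`: the composition integral, read as an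
oscillatory integral, i.e. with `f` and `g` regularized by Gaussians that are then removed
(in the norm of `L²(Ξ)`). If `f` or `g` is in `L²`, its cut-offs are integrable and converge to it
in `L²`, so on `L² × L²` this is the continuous extension of the absolutely convergent
integral formula; an exponential `𝔢_X` is allowed as one of the factors. -/
def IsMagneticProduct {N : ℕ} (B : MagneticField N) (f g p : PhaseSpace N → ℂ) : Prop :=
  MemLp p 2 volume ∧
    Tendsto (fun ε : ℝ =>
        eLpNorm (fun X => magneticIntegral B (gaussCutoff ε f) (gaussCutoff ε g) X - p X) 2 volume)
      (𝓝[>] 0) (𝓝 0)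

/-- The magnetic product `f #^B g` as an `L²` function (determined almost everywhere). -/
def magneticProduct {N : ℕ} (B : MagneticField N) (f g : PhaseSpace N → ℂ) :
    PhaseSpace N → ℂ :=
  open Classical in
  if h : ∃ p, IsMagneticProduct B f g p then h.choose else 0

/-- The bilinear ("real") scalar product `⟨f, g⟩ = ∫ f g`. -/
def realPairing {α : Type*} [MeasureSpace α] (f g : α → ℂ) : ℂ :=
  ∫ x, f x * g x

/-- The magnetic modulation mapping
`[M^B_h(f)](X, Y) = ⟨𝔢_{-X} #^B f #^B 𝔢_{X-Y}, h⟩`. -/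
def modulationMap {N : ℕ} (B : MagneticField N) (h f : PhaseSpace N → ℂ)
    (P : PhaseSpace N × PhaseSpace N) : ℂ :=
  realPairing
    (magneticProduct B (magneticProduct B (phaseExp (-P.1)) f) (phaseExp (P.1 - P.2))) h

end

/-! The partial Fourier transform in the momentum variable turns magnetic multiplication by an
exponential into something elementary. In the composition law the exponent is linear in each of the
two momenta and the flux depends on positions only. The momentum integrals therefore turn the
factors into their partial transforms. If one factor is an exponential, its transform is
concentrated at one point, and what remains is a translation of phase space times a unimodular
multiplier: `twistL`, for left (s = 1) and right (s = -1) multiplication. With the Gaussian cut-off,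
the point mass becomes a heat kernel of width √ε. The regularized product is then an average of
translations over a fixed Gaussian probability measure, and `gaussian_average_tendsto` gives its L²
limit. Conjugating back yields `isMagneticProduct_phaseExp_left` and
`isMagneticProduct_phaseExp_right`, hence existence of both products.

With H and F the partial transforms of the conjugate of h and of f, the modulation map is (2π)^(-N)
times ∫ conj(H(Z)) K(Z) F(Z + shift) dZ. The shift depends only on the positions x, y of X, Y. The
momenta ξ, η enter K only through a constant phase and, in sheared coordinates (a, v), the character
exp(i(ξ·v + η·a)). So for fixed positions the function of (ξ, η) is a Fourier transform on phase
space, and Plancherel removes the momenta. The flux phases have modulus one and disappear from the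
squared norm. The shift is a volume-preserving function of (x, y), so integrating over positions
separates the norms of H and F (`lintegral_enorm_modulationForm_sq`).

This makes the norm of the form a constant times ‖H‖ ‖F‖. Polarizing in both arguments
(`inner_of_norm_eq_mul_norm`) gives the orthogonality relations, and the isometry is the norm
identity after normalization. -/

noncomputable section

/-! ### Plancherel and the multiplication formula for the kernel exp(i v·η). -/

section Plancherel

open FourierTransform SchwartzMap

variable {V : Type*} [NormedAddCommGroup V] [InnerProductSpace ℝ V] [FiniteDimensional ℝ V]
  [MeasurableSpace V] [BorelSpace V]

/-- The `L²` Fourier transform of an integrable function is given by the Fourier integral. -/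
theorem Lp_fourier_toLp_ae_eq {f : V → ℂ} (hf : Integrable f) (hf2 : MemLp f 2 volume) :
    ((𝓕 (hf2.toLp f) : Lp ℂ 2 (volume : Measure V)) : V → ℂ) =ᵐ[volume] 𝓕 f := by
  have h1 : LocallyIntegrable ((𝓕 (hf2.toLp f) : Lp ℂ 2 (volume : Measure V)) : V → ℂ) :=
    (Lp.memLp _).locallyIntegrable (by norm_num)
  have hc : Continuous (𝓕 f) := VectorFourier.fourierIntegral_continuous
    Real.continuous_fourierChar (by exact continuous_inner) hf
  -- Locally integrable functions coincide a.e. if they agree against test functions. The L²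
  -- transform is moved onto the test function by its description as a tempered distribution, the
  -- Fourier integral by Fubini.
  refine ae_eq_of_integral_contDiff_smul_eq h1 hc.locallyIntegrable fun g hg hgs => ?_
  have hg' : HasCompactSupport (Complex.ofRealCLM ∘ g) := hgs.comp_left rfl
  have hgd : ContDiff ℝ ∞ (Complex.ofRealCLM ∘ g) := by fun_prop
  set φ : 𝓢(V, ℂ) := hg'.toSchwartzMap hgd with hφ
  have hφx : ∀ x, φ x = (g x : ℂ) := fun x => rfl
  have key := congrArg (fun T => T φ) (Lp.fourier_toTemperedDistribution_eq (hf2.toLp f))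
  simp only [TemperedDistribution.fourier_apply, Lp.toTemperedDistribution_apply] at key
  have e1 : ∀ F : V → ℂ, ∀ x, g x • F x = φ x • F x := fun F x => by rw [hφx]; simp
  simp only [e1]
  rw [← key]
  have h2 := VectorFourier.integral_fourierIntegral_smul_eq_flip (L := innerₗ V) (f := φ) (g := f)
    (μ := volume) (ν := volume) Real.continuous_fourierChar (by exact continuous_inner)
    φ.integrable hf
  rw [flip_innerₗ] at h2
  refine Eq.trans ?_ h2
  refine integral_congr_ae ?_
  filter_upwards [hf2.coeFn_toLp] with x hx
  rw [hx, SchwartzMap.fourier_coe]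
  rfl

theorem lintegral_enorm_fourier_sq {f : V → ℂ} (hf : Integrable f) (hf2 : MemLp f 2 volume) :
    ∫⁻ w, ‖𝓕 f w‖ₑ ^ 2 = ∫⁻ x, ‖f x‖ₑ ^ 2 := by
  have key : ∀ g : Lp ℂ 2 (volume : Measure V), ∫⁻ x, ‖g x‖ₑ ^ 2 = ‖g‖ₑ ^ 2 := fun g => by
    rw [Lp.enorm_def, eLpNorm_eq_lintegral_rpow_enorm_toReal (by norm_num) (by norm_num)]
    simp only [ENNReal.toReal_ofNat, one_div, ENNReal.rpow_ofNat]
    rw [← ENNReal.rpow_natCast, ← ENNReal.rpow_mul]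
    simp
  have h1 := key (𝓕 (hf2.toLp f))
  have h2 := key (hf2.toLp f)
  rw [lintegral_congr_ae (g := fun w => ‖𝓕 f w‖ₑ ^ 2)] at h1
  · rw [lintegral_congr_ae (g := fun w => ‖f w‖ₑ ^ 2)] at h2
    · rw [h1, h2]
      rw [← ofReal_norm, ← ofReal_norm, Lp.norm_fourier_eq]
    · filter_upwards [hf2.coeFn_toLp] with x hx
      rw [hx]
  · filter_upwards [Lp_fourier_toLp_ae_eq hf hf2] with x hx
    rw [hx]

/-- The Fourier integral `∫ exp(i v·η) f(η) dη`. -/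
def angularFourier (f : V → ℂ) (v : V) : ℂ :=
  ∫ η, Complex.exp (Complex.I * (inner ℝ v η : ℝ)) * f η

theorem angularFourier_eq (f : V → ℂ) (v : V) :
    angularFourier f v = 𝓕 f ((-(2 * Real.pi)⁻¹ : ℝ) • v) := by
  rw [Real.fourier_eq', angularFourier]
  congr 1 with η
  rw [real_inner_smul_right, real_inner_comm, smul_eq_mul]
  congr 2
  have := Real.pi_ne_zero
  push_cast
  field_simp

/-- The kernel differs from the unitary normalization by the dilation v ↦ -v/(2π), whose Jacobian is
the constant. -/
theorem lintegral_enorm_angularFourier_sq {f : V → ℂ} (hf : Integrable f)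
    (hf2 : MemLp f 2 volume) :
    ∫⁻ w, ‖angularFourier f w‖ₑ ^ 2 =
      ENNReal.ofReal ((2 * Real.pi) ^ Module.finrank ℝ V) * ∫⁻ x, ‖f x‖ₑ ^ 2 := by
  simp only [angularFourier_eq]
  have hr : (-(2 * Real.pi)⁻¹ : ℝ) ≠ 0 := by
    have := Real.pi_ne_zero
    simp [this]
  have hc : Continuous (𝓕 f) := VectorFourier.fourierIntegral_continuous
    Real.continuous_fourierChar (by exact continuous_inner) hf
  have h := lintegral_map (μ := (volume : Measure V)) (f := fun w => ‖𝓕 f w‖ₑ ^ 2)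
    (g := fun v => (-(2 * Real.pi)⁻¹ : ℝ) • v) (by fun_prop) (by fun_prop)
  rw [← h, Measure.map_addHaar_smul _ hr, lintegral_smul_measure,
    lintegral_enorm_fourier_sq hf hf2, smul_eq_mul]
  congr 2
  rw [abs_inv, abs_pow, abs_neg, abs_inv, abs_of_pos (by positivity), inv_pow, inv_inv]

theorem integral_angularFourier_mul {f g : V → ℂ} (hf : Integrable f) (hg : Integrable g) :
    ∫ v, angularFourier f v * g v = ∫ v, f v * angularFourier g v := by
  -- The general Fourier integral carries a minus sign in the exponent; the pairing `-innerₗ V`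
  -- compensates for it.
  have h2 := VectorFourier.integral_fourierIntegral_smul_eq_flip (L := -innerₗ V) (f := f) (g := g)
    (μ := volume) (ν := volume) (e := Real.probChar) (by exact Real.continuous_probChar)
    (by
      have := continuous_inner (𝕜 := ℝ) (E := V)
      exact this.neg) hf hg
  have h3 : (-innerₗ V).flip = -innerₗ V := by
    ext x y
    simp [real_inner_comm]
  have h4 : ∀ h : V → ℂ,
      VectorFourier.fourierIntegral Real.probChar volume (-innerₗ V) h = angularFourier h := by
    intro h
    ext v
    rw [VectorFourier.fourierIntegral_probChar, angularFourier]
    congr 1 with η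
    simp [real_inner_comm, mul_comm]
  simpa only [h3, h4, smul_eq_mul] using h2

end Plancherel

/-! ### Square norms and convergence in L². -/

section LTwo

variable {α : Type*} {m0 : MeasurableSpace α} {μ : Measure α}

theorem eLpNorm_two_sq (f : α → ℂ) : eLpNorm f 2 μ ^ 2 = ∫⁻ x, ‖f x‖ₑ ^ 2 ∂μ := by
  rw [eLpNorm_eq_lintegral_rpow_enorm_toReal (by norm_num) (by norm_num)]
  simp only [ENNReal.toReal_ofNat, one_div, ENNReal.rpow_ofNat]
  rw [← ENNReal.rpow_natCast, ← ENNReal.rpow_mul]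
  simp

theorem memLp_two_iff_lintegral {f : α → ℂ} (hf : AEStronglyMeasurable f μ) :
    MemLp f 2 μ ↔ ∫⁻ x, ‖f x‖ₑ ^ 2 ∂μ < ⊤ := by
  rw [← eLpNorm_two_sq, ENNReal.pow_lt_top_iff]
  simp [MemLp, hf]

theorem eLpNorm_two_eq_of_lintegral {f : α → ℂ} {β : Type*} {mβ : MeasurableSpace β}
    {ν : Measure β} {g : β → ℂ} {c : ℝ} (hc : 0 ≤ c)
    (h : ∫⁻ x, ‖f x‖ₑ ^ 2 ∂μ = ENNReal.ofReal (c ^ 2) * ∫⁻ x, ‖g x‖ₑ ^ 2 ∂ν) :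
    eLpNorm f 2 μ = ENNReal.ofReal c * eLpNorm g 2 ν := by
  rw [← eLpNorm_two_sq, ← eLpNorm_two_sq, ENNReal.ofReal_pow hc, ← mul_pow] at h
  exact (ENNReal.pow_right_strictMono two_ne_zero).injective h

theorem tendsto_eLpNorm_two_of_dominated {ι : Type*} {l : Filter ι} [l.IsCountablyGenerated]
    {g : ι → α → ℂ} {F : α → ℂ} (hF : MemLp F 2 μ)
    (hg : ∀ᶠ i in l, AEStronglyMeasurable (g i) μ)
    (hb : ∀ᶠ i in l, ∀ᵐ x ∂μ, ‖g i x‖ ≤ ‖F x‖)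
    (hl : ∀ᵐ x ∂μ, Tendsto (fun i => g i x) l (𝓝 0)) :
    Tendsto (fun i => eLpNorm (g i) 2 μ) l (𝓝 0) := by
  have h : Tendsto (fun i => ∫⁻ x, ‖g i x‖ₑ ^ 2 ∂μ) l (𝓝 (∫⁻ _, 0 ∂μ)) := by
    refine tendsto_lintegral_filter_of_dominated_convergence' (fun x => ‖F x‖ₑ ^ 2) ?_ ?_ ?_ ?_
    · filter_upwards [hg] with i hi
      exact hi.enorm.pow_const 2
    · filter_upwards [hb] with i hi
      filter_upwards [hi] with x hx
      gcongr
      exact enorm_le_iff_norm_le.2 hx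
    · exact ((memLp_two_iff_lintegral hF.1).1 hF).ne
    · filter_upwards [hl] with x hx
      have := (ENNReal.continuous_pow 2).tendsto 0
      simp only [ne_eq, OfNat.ofNat_ne_zero, not_false_eq_true, zero_pow] at this
      refine this.comp ?_
      rw [← tendsto_zero_iff_enorm_tendsto_zero]
      exact hx
  simp only [lintegral_zero, ← eLpNorm_two_sq] at h
  have h2 := (ENNReal.continuous_rpow_const (y := 1 / 2)).tendsto 0 |>.comp h
  rw [ENNReal.zero_rpow_of_pos (by norm_num)] at h2
  refine h2.congr fun i => ?_
  simp only [Function.comp]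
  rw [← ENNReal.rpow_natCast, ← ENNReal.rpow_mul]
  simp

theorem Lp_tendsto_toLp_iff {ι : Type*} {l : Filter ι} {g : ι → α → ℂ} {f : Lp ℂ 2 μ}
    (hg : ∀ i, MemLp (g i) 2 μ) :
    Tendsto (fun i => (hg i).toLp (g i)) l (𝓝 f) ↔
      Tendsto (fun i => eLpNorm (fun x => g i x - f x) 2 μ) l (𝓝 0) := by
  rw [Lp.tendsto_Lp_iff_tendsto_eLpNorm']
  refine tendsto_congr fun i => eLpNorm_congr_ae ?_
  filter_upwards [(hg i).coeFn_toLp] with x hx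
  simp [hx]

end LTwo

/-! ### Gaussian cut-offs of square integrable functions. -/

section GaussianCutoff

variable {N : ℕ}

theorem integrable_exp_neg_mul_norm_sq {b : ℝ} (hb : 0 < b) :
    Integrable (fun v : ConfSpace N => Real.exp (-b * ‖v‖ ^ 2)) := by
  have h := GaussianFourier.integrable_cexp_neg_mul_sq_norm_add (V := ConfSpace N) (b := b)
    (by simpa using hb) 0 0
  refine h.norm.congr (Eventually.of_forall fun v => ?_)
  simp only [Complex.norm_exp]
  norm_num
  left
  norm_cast

theorem integrable_gaussWeight {ε : ℝ} (hε : 0 < ε) :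
    Integrable (fun X : PhaseSpace N => Real.exp (-ε * (‖X.1‖ ^ 2 + ‖X.2‖ ^ 2))) := by
  refine ((integrable_exp_neg_mul_norm_sq hε).mul_prod (integrable_exp_neg_mul_norm_sq hε)).congr
    (Eventually.of_forall fun X => ?_)
  simp only
  rw [← Real.exp_add]
  ring_nf

theorem memLp_gaussWeight {ε : ℝ} (hε : 0 < ε) :
    MemLp (fun X : PhaseSpace N => (Real.exp (-ε * (‖X.1‖ ^ 2 + ‖X.2‖ ^ 2)) : ℂ)) 2 volume := by
  rw [memLp_two_iff_integrable_sq_norm (by fun_prop)]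
  refine (integrable_gaussWeight (N := N) (ε := 2 * ε) (by positivity)).congr
    (Eventually.of_forall fun X => ?_)
  simp only [Complex.norm_real, Real.norm_eq_abs, sq_abs]
  rw [← Real.exp_nat_mul]
  push_cast
  ring_nf

theorem norm_gaussCutoff_le {ε : ℝ} (hε : 0 ≤ ε) (f : PhaseSpace N → ℂ) (X : PhaseSpace N) :
    ‖gaussCutoff ε f X‖ ≤ ‖f X‖ := by
  rw [gaussCutoff, norm_mul, Complex.norm_real, Real.norm_eq_abs, Real.abs_exp]
  refine mul_le_of_le_one_left (norm_nonneg _) (Real.exp_le_one_iff.2 ?_)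
  have : 0 ≤ ε * (‖X.1‖ ^ 2 + ‖X.2‖ ^ 2) := by positivity
  linarith

theorem aestronglyMeasurable_gaussCutoff (ε : ℝ) {f : PhaseSpace N → ℂ}
    (hf : AEStronglyMeasurable f volume) : AEStronglyMeasurable (gaussCutoff ε f) volume := by
  refine AEStronglyMeasurable.mul ?_ hf
  fun_prop

theorem memLp_gaussCutoff {ε : ℝ} (hε : 0 ≤ ε) {f : PhaseSpace N → ℂ} (hf : MemLp f 2 volume) :
    MemLp (gaussCutoff ε f) 2 volume :=
  hf.of_le (aestronglyMeasurable_gaussCutoff ε hf.1)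
    (Eventually.of_forall fun X => norm_gaussCutoff_le hε f X)

theorem integrable_gaussCutoff {ε : ℝ} (hε : 0 < ε) {f : PhaseSpace N → ℂ}
    (hf : MemLp f 2 volume) : Integrable (gaussCutoff ε f) :=
  (memLp_gaussWeight hε).integrable_mul hf

theorem tendsto_gaussCutoff {f : PhaseSpace N → ℂ} (hf : MemLp f 2 volume) :
    Tendsto (fun ε : ℝ => eLpNorm (fun X => gaussCutoff ε f X - f X) 2 volume)
      (𝓝[>] 0) (𝓝 0) := by
  refine tendsto_eLpNorm_two_of_dominated (F := fun X => 2 * f X) (hf.const_mul 2) ?_ ?_ ?_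
  · exact Eventually.of_forall fun ε => (aestronglyMeasurable_gaussCutoff ε hf.1).sub hf.1
  · filter_upwards [self_mem_nhdsWithin] with ε hε
    refine Eventually.of_forall fun X => ?_
    refine (norm_sub_le _ _).trans ?_
    have := norm_gaussCutoff_le (le_of_lt hε) f X
    simp only [norm_mul, Complex.norm_ofNat]
    linarith
  · refine Eventually.of_forall fun X => ?_
    have hc : Continuous fun ε : ℝ => gaussCutoff ε f X - f X := by
      unfold gaussCutoff
      fun_prop
    have := hc.tendsto 0
    simp only [gaussCutoff, neg_zero, zero_mul, Real.exp_zero, Complex.ofReal_one, one_mul,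
      sub_self] at this
    exact this.mono_left nhdsWithin_le_nhds

end GaussianCutoff

/-! ### The partial Fourier transform given by an integral. -/

section PartialFourier

variable {N : ℕ}

/-- The Fourier integral in the second phase space variable. -/
def partialFourier (f : PhaseSpace N → ℂ) (P : PhaseSpace N) : ℂ :=
  angularFourier (fun η => f (P.1, η)) P.2

theorem ae_ae_of_ae_phaseSpace {p : PhaseSpace N → Prop} (h : ∀ᵐ P, p P) :
    ∀ᵐ x : ConfSpace N, ∀ᵐ η : ConfSpace N, p (x, η) := by
  rw [Measure.volume_eq_prod] at h
  exact Measure.ae_ae_of_ae_prod h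

/-- Almost every section `f (x, ·)` is integrable. -/
def FiberIntegrable (f : PhaseSpace N → ℂ) : Prop :=
  ∀ᵐ x : ConfSpace N, Integrable fun η : ConfSpace N => f (x, η)

theorem FiberIntegrable.of_integrable {f : PhaseSpace N → ℂ} (hf : Integrable f) :
    FiberIntegrable f := by
  rw [Measure.volume_eq_prod] at hf
  exact hf.prod_right_ae

theorem FiberIntegrable.congr {f g : PhaseSpace N → ℂ} (hf : FiberIntegrable f)
    (h : f =ᵐ[volume] g) : FiberIntegrable g := by
  have h' : ∀ᵐ x : ConfSpace N, ∀ᵐ η : ConfSpace N, f (x, η) = g (x, η) :=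
    ae_ae_of_ae_phaseSpace h
  filter_upwards [hf, h'] with x h1 h2
  exact h1.congr h2

theorem partialFourier_congr {f g : PhaseSpace N → ℂ} (h : f =ᵐ[volume] g) :
    partialFourier f =ᵐ[volume] partialFourier g := by
  have h' : ∀ᵐ x : ConfSpace N, ∀ᵐ η : ConfSpace N, f (x, η) = g (x, η) :=
    ae_ae_of_ae_phaseSpace h
  have h2 : ∀ᵐ P : PhaseSpace N, ∀ᵐ η : ConfSpace N, f (P.1, η) = g (P.1, η) :=
    Measure.quasiMeasurePreserving_fst.ae h'
  filter_upwards [h2] with P hP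
  refine integral_congr_ae ?_
  filter_upwards [hP] with η hη
  rw [hη]

theorem aestronglyMeasurable_partialFourier {f : PhaseSpace N → ℂ}
    (hf : AEStronglyMeasurable f volume) : AEStronglyMeasurable (partialFourier f) volume := by
  refine AEStronglyMeasurable.congr ?_ (partialFourier_congr hf.ae_eq_mk.symm)
  refine StronglyMeasurable.aestronglyMeasurable ?_
  unfold partialFourier angularFourier
  refine StronglyMeasurable.integral_prod_right' (f := fun q : PhaseSpace N × ConfSpace N =>
    Complex.exp (Complex.I * (inner ℝ q.1.2 q.2 : ℝ)) * hf.mk f (q.1.1, q.2)) ?_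
  refine StronglyMeasurable.mul ?_ ?_
  · exact Continuous.stronglyMeasurable (by fun_prop)
  · exact hf.stronglyMeasurable_mk.comp_measurable (by fun_prop)

theorem memLp_two_sections {f : PhaseSpace N → ℂ} (hf : MemLp f 2 volume) :
    ∀ᵐ x : ConfSpace N, MemLp (fun η : ConfSpace N => f (x, η)) 2 volume := by
  have h1 : Integrable (fun P : PhaseSpace N => ‖f P‖ ^ 2) volume :=
    (memLp_two_iff_integrable_sq_norm hf.1).1 hf
  have h0 := hf.1
  rw [Measure.volume_eq_prod] at h0 h1
  have h2 : ∀ᵐ x : ConfSpace N, Integrable fun η : ConfSpace N => ‖f (x, η)‖ ^ 2 :=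
    h1.prod_right_ae
  have h3 : ∀ᵐ x : ConfSpace N, AEStronglyMeasurable (fun η : ConfSpace N => f (x, η)) volume :=
    h0.prodMk_left
  filter_upwards [h2, h3] with x hx hx'
  exact (memLp_two_iff_integrable_sq_norm hx').2 hx

/-- Plancherel on almost every fibre, then Tonelli. Only integrability along the fibres is required,
because that is what is later available for `gaussTwist`. -/
theorem lintegral_enorm_partialFourier_sq {f : PhaseSpace N → ℂ} (hf : MemLp f 2 volume)
    (hfi : FiberIntegrable f) :
    ∫⁻ P, ‖partialFourier f P‖ₑ ^ 2 =
      ENNReal.ofReal ((2 * Real.pi) ^ N) * ∫⁻ P, ‖f P‖ₑ ^ 2 := by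
  rw [Measure.volume_eq_prod, lintegral_prod _
      ((aestronglyMeasurable_partialFourier hf.1).enorm.pow_const 2),
    lintegral_prod _ (hf.1.enorm.pow_const 2), ← lintegral_const_mul'' _ ?_]
  · refine lintegral_congr_ae ?_
    filter_upwards [hfi, memLp_two_sections hf] with x h1 h2
    have := lintegral_enorm_angularFourier_sq h1 h2
    rw [finrank_euclideanSpace_fin] at this
    exact this
  · exact AEMeasurable.lintegral_prod_right' (hf.1.enorm.pow_const 2)

/-- The normalization constant `(2π)^(N/2)` of the partial Fourier transform. -/
def fourierConst (N : ℕ) : ℝ := √((2 * Real.pi) ^ N)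

theorem fourierConst_sq (N : ℕ) : fourierConst N ^ 2 = (2 * Real.pi) ^ N :=
  Real.sq_sqrt (by positivity)

theorem fourierConst_pos (N : ℕ) : 0 < fourierConst N := Real.sqrt_pos.2 (by positivity)

theorem eLpNorm_partialFourier {f : PhaseSpace N → ℂ} (hf : MemLp f 2 volume)
    (hfi : FiberIntegrable f) :
    eLpNorm (partialFourier f) 2 volume =
      ENNReal.ofReal (fourierConst N) * eLpNorm f 2 volume := by
  refine eLpNorm_two_eq_of_lintegral (fourierConst_pos N).le ?_
  rw [fourierConst_sq, lintegral_enorm_partialFourier_sq hf hfi]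

theorem memLp_partialFourier {f : PhaseSpace N → ℂ} (hf : MemLp f 2 volume)
    (hfi : FiberIntegrable f) : MemLp (partialFourier f) 2 volume := by
  refine ⟨aestronglyMeasurable_partialFourier hf.1, ?_⟩
  rw [eLpNorm_partialFourier hf hfi]
  exact ENNReal.mul_lt_top ENNReal.ofReal_lt_top hf.2

end PartialFourier

/-! ### The partial Fourier transform on L² and its inverse. -/

section PartialFourierLp

variable {N : ℕ}

/-- The Hilbert space `L²(Ξ)`. -/
abbrev PhaseLp (N : ℕ) : Type := Lp ℂ 2 (volume : Measure (PhaseSpace N))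

theorem integral_phaseSpace {f : PhaseSpace N → ℂ} (hf : Integrable f) :
    ∫ P, f P = ∫ x : ConfSpace N, ∫ η : ConfSpace N, f (x, η) := by
  rw [Measure.volume_eq_prod] at hf ⊢
  exact integral_prod _ hf

theorem integrable_exp_inner_mul {f : ConfSpace N → ℂ} (hf : Integrable f) (v : ConfSpace N) :
    Integrable fun η : ConfSpace N => Complex.exp (Complex.I * (inner ℝ v η : ℝ)) * f η := by
  refine hf.bdd_mul (c := 1) (Continuous.aestronglyMeasurable (by fun_prop))
    (Eventually.of_forall fun η => ?_)
  rw [mul_comm, Complex.norm_exp_ofReal_mul_I]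

theorem angularFourier_add {f g : ConfSpace N → ℂ} (hf : Integrable f) (hg : Integrable g)
    (v : ConfSpace N) :
    angularFourier (fun η => f η + g η) v = angularFourier f v + angularFourier g v := by
  simp only [angularFourier, mul_add]
  exact integral_add (integrable_exp_inner_mul hf v) (integrable_exp_inner_mul hg v)

theorem angularFourier_const_mul (c : ℂ) (f : ConfSpace N → ℂ) (v : ConfSpace N) :
    angularFourier (fun η => c * f η) v = c * angularFourier f v := by
  simp only [angularFourier, mul_left_comm _ c]
  exact integral_const_mul _ _

theorem angularFourier_comp_neg (f : ConfSpace N → ℂ) (v : ConfSpace N) :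
    angularFourier (fun η => f (-η)) v = angularFourier f (-v) := by
  simp only [angularFourier]
  rw [← integral_neg_eq_self]
  simp

theorem conj_angularFourier (f : ConfSpace N → ℂ) (v : ConfSpace N) :
    conj (angularFourier f v) = angularFourier (fun η => conj (f η)) (-v) := by
  simp only [angularFourier]
  rw [← integral_conj]
  congr 1 with η
  simp [← Complex.exp_conj]

theorem FiberIntegrable.add {f g : PhaseSpace N → ℂ} (hf : FiberIntegrable f)
    (hg : FiberIntegrable g) : FiberIntegrable fun P => f P + g P := by
  filter_upwards [hf, hg] with x h1 h2
  exact h1.add h2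

theorem FiberIntegrable.const_mul {f : PhaseSpace N → ℂ} (hf : FiberIntegrable f) (c : ℂ) :
    FiberIntegrable fun P => c * f P := by
  filter_upwards [hf] with x h1
  exact h1.const_mul c

variable (N) in
/-- The square integrable functions on phase space with integrable sections. -/
def fiberIntegrableSubmodule : Submodule ℂ (PhaseLp N) where
  carrier := {f | FiberIntegrable f}
  add_mem' {f g} hf hg :=
    (FiberIntegrable.add hf hg).congr (Lp.coeFn_add f g).symm
  zero_mem' := by
    have h : FiberIntegrable (fun _ : PhaseSpace N => (0 : ℂ)) :=
      Eventually.of_forall fun x => integrable_zero _ _ _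
    exact h.congr (Lp.coeFn_zero _ _ _).symm
  smul_mem' c f hf := (FiberIntegrable.const_mul hf c).congr (Lp.coeFn_smul c f).symm

theorem ae_phaseSpace_of_ae_fst {p : ConfSpace N → Prop} (h : ∀ᵐ x, p x) :
    ∀ᵐ P : PhaseSpace N, p P.1 :=
  Measure.quasiMeasurePreserving_fst.ae h

variable (N) in
/-- The partial Fourier transform of square integrable functions with integrable sections. -/
def partialFourierLM : fiberIntegrableSubmodule N →ₗ[ℂ] PhaseLp N where
  toFun f := (memLp_partialFourier (Lp.memLp (f : PhaseLp N)) f.2).toLp _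
  map_add' f g := by
    rw [← MemLp.toLp_add, MemLp.toLp_eq_toLp_iff]
    refine (partialFourier_congr (Lp.coeFn_add (f : PhaseLp N) (g : PhaseLp N))).trans ?_
    filter_upwards [ae_phaseSpace_of_ae_fst f.2, ae_phaseSpace_of_ae_fst g.2] with P h1 h2
    exact angularFourier_add h1 h2 _
  map_smul' c f := by
    rw [RingHom.id_apply, ← MemLp.toLp_const_smul, MemLp.toLp_eq_toLp_iff]
    refine (partialFourier_congr (Lp.coeFn_smul c (f : PhaseLp N))).trans ?_
    filter_upwards with P
    exact angularFourier_const_mul c _ _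

theorem dense_fiberIntegrable : DenseRange (fiberIntegrableSubmodule N).subtype := by
  intro f
  -- The absolute value makes the cut-off square integrable for every real ε, so that `toLp` is a
  -- total function of ε; only ε > 0 matters in the limit.
  have hm : ∀ ε : ℝ, MemLp (gaussCutoff |ε| f) 2 volume := fun ε =>
    memLp_gaussCutoff (abs_nonneg ε) (Lp.memLp f)
  have ht : Tendsto (fun ε : ℝ => (hm ε).toLp _) (𝓝[>] 0) (𝓝 f) := by
    rw [Lp_tendsto_toLp_iff]
    refine (tendsto_gaussCutoff (Lp.memLp f)).congr' ?_
    filter_upwards [self_mem_nhdsWithin] with ε hε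
    rw [abs_of_pos hε]
  refine mem_closure_of_tendsto ht ?_
  filter_upwards [self_mem_nhdsWithin] with ε hε
  refine ⟨⟨(hm ε).toLp _, ?_⟩, rfl⟩
  exact (FiberIntegrable.of_integrable (integrable_gaussCutoff (abs_pos.2 (ne_of_gt hε))
    (Lp.memLp f))).congr (hm ε).coeFn_toLp.symm

theorem norm_partialFourierLM (f : fiberIntegrableSubmodule N) :
    ‖partialFourierLM N f‖ = fourierConst N * ‖f‖ := by
  rw [partialFourierLM, LinearMap.coe_mk, AddHom.coe_mk, Lp.norm_toLp,
    eLpNorm_partialFourier (Lp.memLp _) f.2, ENNReal.toReal_mul,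
    ENNReal.toReal_ofReal (fourierConst_pos N).le]
  rfl

variable (N) in
/-- The partial Fourier transform on `L²(Ξ)`. -/
def partialFourierL : PhaseLp N →L[ℂ] PhaseLp N :=
  (partialFourierLM N).extendOfNorm (fiberIntegrableSubmodule N).subtype

theorem partialFourierL_coe (f : fiberIntegrableSubmodule N) :
    partialFourierL N f = partialFourierLM N f :=
  LinearMap.extendOfNorm_eq dense_fiberIntegrable
    ⟨fourierConst N, fun f => (norm_partialFourierLM f).le⟩ f

theorem partialFourierL_toLp {f : PhaseSpace N → ℂ} (hf : MemLp f 2 volume)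
    (hfi : FiberIntegrable f) :
    partialFourierL N (hf.toLp f) = (memLp_partialFourier hf hfi).toLp _ := by
  have h := partialFourierL_coe ⟨hf.toLp f, hfi.congr hf.coeFn_toLp.symm⟩
  refine h.trans ?_
  simp only [partialFourierLM, LinearMap.coe_mk, AddHom.coe_mk]
  rw [MemLp.toLp_eq_toLp_iff]
  exact partialFourier_congr hf.coeFn_toLp

theorem partialFourierL_coe_ae_eq (f : fiberIntegrableSubmodule N) :
    partialFourierL N f =ᵐ[volume] partialFourier (f : PhaseLp N) := by
  rw [partialFourierL_coe]
  exact MemLp.coeFn_toLp (memLp_partialFourier (Lp.memLp (f : PhaseLp N)) f.2)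

theorem norm_partialFourierL (f : PhaseLp N) :
    ‖partialFourierL N f‖ = fourierConst N * ‖f‖ := by
  refine dense_fiberIntegrable.induction_on (p := fun f : PhaseLp N =>
    ‖partialFourierL N f‖ = fourierConst N * ‖f‖) f ?_ fun f => ?_
  · exact isClosed_eq (by fun_prop) (by fun_prop)
  · rw [Submodule.subtype_apply, partialFourierL_coe, norm_partialFourierLM]
    rfl

theorem inner_eq_of_norm_eq {H K : Type*} [NormedAddCommGroup H] [InnerProductSpace ℂ H]
    [NormedAddCommGroup K] [InnerProductSpace ℂ K] {c : ℝ} (T : H →ₗ[ℂ] K)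
    (hT : ∀ f, ‖T f‖ = c * ‖f‖) (f g : H) :
    inner ℂ (T f) (T g) = (c ^ 2 : ℝ) * inner ℂ f g := by
  rw [inner_eq_sum_norm_sq_div_four, inner_eq_sum_norm_sq_div_four]
  simp only [← map_add, ← map_sub, ← map_smul, hT]
  have h : ∀ x : ℝ, (RCLike.ofReal x : ℂ) = Complex.ofReal x := fun _ => rfl
  simp only [h]
  push_cast
  ring

theorem inner_partialFourierL (f g : PhaseLp N) :
    inner ℂ (partialFourierL N f) (partialFourierL N g) = ((2 * Real.pi) ^ N : ℝ) * inner ℂ f g := by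
  rw [← fourierConst_sq]
  exact inner_eq_of_norm_eq (partialFourierL N).toLinearMap norm_partialFourierL f g

/-- The reflection of the second phase space variable. -/
def reflectSnd (P : PhaseSpace N) : PhaseSpace N := (P.1, -P.2)

theorem measurePreserving_reflectSnd :
    MeasurePreserving (reflectSnd (N := N)) volume volume :=
  (MeasurePreserving.id _).prod (Measure.measurePreserving_neg _)

variable (N) in
/-- The reflection of the second variable on `L²(Ξ)`. -/
def reflectL : PhaseLp N →ₗᵢ[ℂ] PhaseLp N :=
  Lp.compMeasurePreservingₗᵢ ℂ reflectSnd measurePreserving_reflectSnd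

theorem reflectL_ae_eq (f : PhaseLp N) : reflectL N f =ᵐ[volume] fun P => f (reflectSnd P) :=
  Lp.coeFn_compMeasurePreserving f measurePreserving_reflectSnd

theorem reflectL_mem (f : fiberIntegrableSubmodule N) :
    reflectL N f ∈ fiberIntegrableSubmodule N := by
  have h : FiberIntegrable fun P => (f : PhaseLp N) (reflectSnd P) := by
    filter_upwards [f.2] with x hx
    exact hx.comp_neg
  exact h.congr (reflectL_ae_eq _).symm

theorem reflectL_partialFourierL (f : PhaseLp N) :
    reflectL N (partialFourierL N f) = partialFourierL N (reflectL N f) := by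
  refine dense_fiberIntegrable.induction_on (p := fun f : PhaseLp N =>
    reflectL N (partialFourierL N f) = partialFourierL N (reflectL N f)) f ?_ fun f => ?_
  · exact isClosed_eq (by fun_prop) (by fun_prop)
  · apply Lp.ext
    refine (reflectL_ae_eq _).trans (EventuallyEq.trans ?_
      (partialFourierL_coe_ae_eq ⟨_, reflectL_mem f⟩).symm)
    refine EventuallyEq.trans ?_ (partialFourier_congr (reflectL_ae_eq _)).symm
    filter_upwards [measurePreserving_reflectSnd.quasiMeasurePreserving.ae
      (partialFourierL_coe_ae_eq f)] with P hP
    rw [Submodule.subtype_apply, hP]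
    exact (angularFourier_comp_neg _ _).symm

/-- On each fibre this is the multiplication formula ∫ f̂ g = ∫ f ĝ. Conjugation reverses the sign
in the exponential, hence the reflection. Density then covers all of L². -/
theorem inner_partialFourierL_left (f g : PhaseLp N) :
    inner ℂ (partialFourierL N f) g = inner ℂ f (reflectL N (partialFourierL N g)) := by
  refine dense_fiberIntegrable.induction_on₂ (p := fun f g : PhaseLp N =>
    inner ℂ (partialFourierL N f) g = inner ℂ f (reflectL N (partialFourierL N g))) ?_ ?_ f g
  · exact isClosed_eq (by fun_prop) (by fun_prop)
  · intro f g
    simp only [Submodule.subtype_apply]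
    have h1 : Integrable fun P => inner ℂ (partialFourierL N f P) ((g : PhaseLp N) P) :=
      L2.integrable_inner _ _
    have h2 : Integrable fun P => inner ℂ ((f : PhaseLp N) P)
        (reflectL N (partialFourierL N g) P) := L2.integrable_inner _ _
    have e1 : (fun P => inner ℂ (partialFourierL N f P) ((g : PhaseLp N) P)) =ᵐ[volume]
        fun P => (g : PhaseLp N) P * conj (partialFourier (f : PhaseLp N) P) := by
      filter_upwards [partialFourierL_coe_ae_eq f] with P hP
      rw [hP, RCLike.inner_apply]
    have e2 : (fun P => inner ℂ ((f : PhaseLp N) P) (reflectL N (partialFourierL N g) P))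
        =ᵐ[volume] fun P =>
          partialFourier (g : PhaseLp N) (reflectSnd P) * conj ((f : PhaseLp N) P) := by
      filter_upwards [reflectL_ae_eq (partialFourierL N g),
        measurePreserving_reflectSnd.quasiMeasurePreserving.ae (partialFourierL_coe_ae_eq g)]
        with P hP hP2
      rw [hP, hP2, RCLike.inner_apply]
    rw [L2.inner_def, L2.inner_def, integral_congr_ae e1, integral_congr_ae e2]
    replace h1 := h1.congr e1
    replace h2 := h2.congr e2
    rw [integral_phaseSpace h1, integral_phaseSpace h2]
    refine integral_congr_ae ?_
    filter_upwards [f.2, g.2] with x hf hg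
    have h3 := integral_angularFourier_mul (f := fun η => conj ((f : PhaseLp N) (x, η)))
      (g := fun η => (g : PhaseLp N) (x, -η)) ((Complex.conjCLE.integrable_comp_iff).2 hf) hg.comp_neg
    rw [← integral_neg_eq_self]
    simp only [partialFourier, conj_angularFourier, reflectSnd, neg_neg]
    have h4 := angularFourier_comp_neg fun η => (g : PhaseLp N) (x, η)
    simp only [h4] at h3
    simpa only [mul_comm] using h3

/-- The inverse partial Fourier transform on `L²(Ξ)`. -/
def partialFourierInvL (f : PhaseLp N) : PhaseLp N :=
  ((((2 * Real.pi) ^ N)⁻¹ : ℝ) : ℂ) • reflectL N (partialFourierL N f)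

/-- Fourier inversion in L²: an isometry up to a factor, composed with its adjoint, is a multiple of
the identity. It makes the transform surjective. -/
theorem reflectL_partialFourierL_partialFourierL (f : PhaseLp N) :
    reflectL N (partialFourierL N (partialFourierL N f)) = (((2 * Real.pi) ^ N : ℝ) : ℂ) • f := by
  refine ext_inner_left ℂ fun g => ?_
  rw [← inner_partialFourierL_left, inner_partialFourierL, inner_smul_right]

theorem partialFourierL_partialFourierInvL (f : PhaseLp N) :
    partialFourierL N (partialFourierInvL f) = f := by
  rw [partialFourierInvL, map_smul, ← reflectL_partialFourierL,
    reflectL_partialFourierL_partialFourierL, smul_smul, ← Complex.ofReal_mul,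
    inv_mul_cancel₀ (by positivity), Complex.ofReal_one, one_smul]

theorem inner_partialFourierInvL (f g : PhaseLp N) :
    inner ℂ f (partialFourierInvL g) =
      ((((2 * Real.pi) ^ N)⁻¹ : ℝ) : ℂ) * inner ℂ (partialFourierL N f) g := by
  rw [partialFourierInvL, inner_smul_right, inner_partialFourierL_left]

theorem norm_partialFourierInvL (f : PhaseLp N) :
    ‖partialFourierInvL f‖ = (fourierConst N)⁻¹ * ‖f‖ := by
  have h := norm_partialFourierL (partialFourierInvL f)
  rw [partialFourierL_partialFourierInvL] at h
  rw [h, inv_mul_cancel_left₀ (fourierConst_pos N).ne']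

theorem partialFourierInvL_sub (f g : PhaseLp N) :
    partialFourierInvL (f - g) = partialFourierInvL f - partialFourierInvL g := by
  simp only [partialFourierInvL, map_sub, smul_sub]

theorem partialFourierInvL_ae_eq {f : PhaseSpace N → ℂ} (hf : MemLp f 2 volume)
    (hfi : FiberIntegrable f) :
    partialFourierInvL (hf.toLp f) =ᵐ[volume] fun P =>
      ((((2 * Real.pi) ^ N)⁻¹ : ℝ) : ℂ) * partialFourier f (reflectSnd P) := by
  rw [partialFourierInvL]
  refine (Lp.coeFn_smul _ _).trans ?_
  filter_upwards [reflectL_ae_eq (partialFourierL N (hf.toLp f)),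
    measurePreserving_reflectSnd.quasiMeasurePreserving.ae
      (partialFourierL_coe_ae_eq ⟨hf.toLp f, hfi.congr hf.coeFn_toLp.symm⟩),
    measurePreserving_reflectSnd.quasiMeasurePreserving.ae
      (partialFourier_congr hf.coeFn_toLp)] with P h1 h2 h3
  rw [Pi.smul_apply, h1, h2, h3, smul_eq_mul]

end PartialFourierLp

/-! ### Averages of translations over a Gaussian probability measure. -/

section GaussianAverage

theorem MemLp.ae_memLp_two_section {α β : Type*} {mα : MeasurableSpace α} {mβ : MeasurableSpace β}
    {μ : Measure α} {ν : Measure β} [SFinite μ] [SFinite ν] {f : α × β → ℂ}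
    (hf : MemLp f 2 (μ.prod ν)) : ∀ᵐ y ∂ν, MemLp (fun x => f (x, y)) 2 μ := by
  have h1 : Integrable (fun q => ‖f q‖ ^ 2) (μ.prod ν) :=
    (memLp_two_iff_integrable_sq_norm hf.1).1 hf
  filter_upwards [h1.prod_left_ae, hf.1.prodMk_right] with y hy hy'
  exact (memLp_two_iff_integrable_sq_norm hy').2 hy

/-- On a probability space the L¹ norm is at most the L² norm; apply this for each y and integrate.
-/
theorem eLpNorm_two_integral_le {α β : Type*} {mα : MeasurableSpace α} {mβ : MeasurableSpace β}
    {μ : Measure α} {ν : Measure β} [IsProbabilityMeasure μ] [SFinite ν] {f : α × β → ℂ}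
    (hf : AEStronglyMeasurable f (μ.prod ν)) :
    eLpNorm (fun y => ∫ x, f (x, y) ∂μ) 2 ν ≤ eLpNorm f 2 (μ.prod ν) := by
  have h : eLpNorm (fun y => ∫ x, f (x, y) ∂μ) 2 ν ^ 2 ≤ eLpNorm f 2 (μ.prod ν) ^ 2 := by
    rw [eLpNorm_two_sq, eLpNorm_two_sq, lintegral_prod_symm _ (hf.enorm.pow_const 2)]
    refine lintegral_mono_ae ?_
    filter_upwards [hf.prodMk_right] with y hy
    rw [← eLpNorm_two_sq (fun x => f (x, y))]
    gcongr
    calc ‖∫ x, f (x, y) ∂μ‖ₑ ≤ ∫⁻ x, ‖f (x, y)‖ₑ ∂μ := enorm_integral_le_lintegral_enorm _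
      _ = eLpNorm (fun x => f (x, y)) 1 μ := eLpNorm_one_eq_lintegral_enorm.symm
      _ ≤ eLpNorm (fun x => f (x, y)) 2 μ :=
        eLpNorm_le_eLpNorm_of_exponent_le (by norm_num) hy
  exact (ENNReal.pow_le_pow_left_iff two_ne_zero).1 h

variable {N : ℕ}

/-- The heat kernel at time one. -/
def heatDensity (w : ConfSpace N) : ℝ :=
  ((2 * √Real.pi) ^ N)⁻¹ * Real.exp (-(1 / 4) * ‖w‖ ^ 2)

theorem heatDensity_nonneg (w : ConfSpace N) : 0 ≤ heatDensity w := by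
  unfold heatDensity
  positivity

theorem continuous_heatDensity : Continuous (heatDensity (N := N)) := by
  unfold heatDensity
  fun_prop

theorem cpow_half_nat {b : ℝ} (hb : 0 ≤ b) (N : ℕ) :
    (b : ℂ) ^ ((N : ℂ) / 2) = ((√b ^ N : ℝ) : ℂ) := by
  rw [Real.sqrt_eq_rpow, ← Real.rpow_mul_natCast hb, Complex.ofReal_cpow hb]
  push_cast
  ring_nf

theorem integral_heatDensity : ∫ w : ConfSpace N, heatDensity w = 1 := by
  unfold heatDensity
  rw [integral_const_mul, GaussianFourier.integral_rexp_neg_mul_sq_norm (by norm_num),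
    finrank_euclideanSpace_fin]
  have h : (Real.pi / (1 / 4)) ^ ((N : ℝ) / 2) = (2 * √Real.pi) ^ N := by
    have h4 : 2 * √Real.pi = √(Real.pi / (1 / 4)) := by
      rw [show Real.pi / (1 / 4) = 2 ^ 2 * Real.pi by ring, Real.sqrt_mul (by norm_num),
        Real.sqrt_sq (by norm_num)]
    rw [h4, Real.sqrt_eq_rpow, ← Real.rpow_mul_natCast (by positivity)]
    ring_nf
  rw [h, inv_mul_cancel₀]
  have := Real.pi_pos
  positivity

variable (N) in
/-- The Gaussian probability measure whose density is the heat kernel at time one. -/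
def heatMeasure : Measure (ConfSpace N) :=
  volume.withDensity fun w => ENNReal.ofReal (heatDensity w)

instance isProbabilityMeasure_heatMeasure : IsProbabilityMeasure (heatMeasure N) := by
  refine ⟨?_⟩
  rw [heatMeasure, withDensity_apply _ MeasurableSet.univ, Measure.restrict_univ,
    ← ofReal_integral_eq_lintegral_ofReal _ (Eventually.of_forall heatDensity_nonneg),
    integral_heatDensity, ENNReal.ofReal_one]
  exact (integrable_exp_neg_mul_norm_sq (by norm_num)).const_mul _

theorem integral_heatMeasure (f : ConfSpace N → ℂ) :
    ∫ w, f w ∂heatMeasure N = ∫ w, (heatDensity w : ℂ) * f w := by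
  rw [heatMeasure, integral_withDensity_eq_integral_toReal_smul
    (f := fun w => ENNReal.ofReal (heatDensity w)) continuous_heatDensity.measurable.ennreal_ofReal
    (Eventually.of_forall fun w => ENNReal.ofReal_lt_top)]
  simp only [ENNReal.toReal_ofReal (heatDensity_nonneg _), Complex.real_smul]

/-- The shear `(w, P) ↦ P + a - s ℓ(w)`. -/
def shearMap (a : PhaseSpace N) (ℓ : ConfSpace N →L[ℝ] PhaseSpace N) (s : ℝ) :
    C(ConfSpace N × PhaseSpace N, PhaseSpace N) :=
  ⟨fun q => q.2 + a - s • ℓ q.1, by fun_prop⟩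

theorem continuous_shearMap (a : PhaseSpace N) (ℓ : ConfSpace N →L[ℝ] PhaseSpace N) :
    Continuous (shearMap a ℓ) := by
  refine ContinuousMap.continuous_of_continuous_uncurry _ ?_
  simp only [shearMap, Function.uncurry_def, ContinuousMap.coe_mk]
  fun_prop

theorem measurePreserving_shearMap (a : PhaseSpace N) (ℓ : ConfSpace N →L[ℝ] PhaseSpace N) (s : ℝ) :
    MeasurePreserving (shearMap a ℓ s) ((heatMeasure N).prod volume) volume := by
  have h : MeasurePreserving (fun q : ConfSpace N × PhaseSpace N => (q.1, q.2 + (a - s • ℓ q.1)))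
      ((heatMeasure N).prod volume) ((heatMeasure N).prod volume) := by
    refine (MeasurePreserving.id (heatMeasure N)).skew_product
      (g := fun w P => P + (a - s • ℓ w)) (by fun_prop) (Eventually.of_forall fun w => ?_)
    exact map_add_right_eq_self ((volume : Measure (ConfSpace N)).prod volume) (a - s • ℓ w)
  have h2 := measurePreserving_snd.comp h
  convert h2 using 1
  ext q : 1
  simp only [shearMap, ContinuousMap.coe_mk, Function.comp]
  abel

/-- The average is lifted to the product of the heat measure with phase space. There each shear is a
measure preserving map to phase space, and integrating out w is a contraction, so it suffices that
the lifted integrands converge in L² of the product. -/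
theorem gaussian_average_tendsto {F : PhaseLp N} {G : ℝ → PhaseSpace N → ℂ}
    (hG : ∀ ε, 0 < ε → MemLp (G ε) 2 volume)
    (hGF : Tendsto (fun ε => eLpNorm (fun P => G ε P - F P) 2 volume) (𝓝[>] 0) (𝓝 0))
    {κ : ℝ → PhaseSpace N → ConfSpace N → ℂ}
    (hκ : Continuous fun q : ℝ × PhaseSpace N × ConfSpace N => κ q.1 q.2.1 q.2.2)
    (hκ1 : ∀ ε, 0 ≤ ε → ∀ P w, ‖κ ε P w‖ ≤ 1)
    (a : PhaseSpace N) (ℓ : ConfSpace N →L[ℝ] PhaseSpace N) :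
    (∀ ε, 0 < ε → MemLp (fun P => ∫ w, κ ε P (√ε • w) * G ε (P + a - √ε • ℓ w) ∂heatMeasure N)
      2 volume) ∧
    Tendsto (fun ε => eLpNorm (fun P =>
      (∫ w, κ ε P (√ε • w) * G ε (P + a - √ε • ℓ w) ∂heatMeasure N) - κ 0 P 0 * F (P + a)) 2 volume)
      (𝓝[>] 0) (𝓝 0) := by
  set ν := (heatMeasure N).prod (volume : Measure (PhaseSpace N)) with hν
  set A : ℝ → ConfSpace N × PhaseSpace N → ℂ :=
    fun ε q => κ ε q.2 (√ε • q.1) * G ε (shearMap a ℓ (√ε) q) with hA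
  set A0 : ConfSpace N × PhaseSpace N → ℂ :=
    fun q => κ 0 q.2 0 * F (shearMap a ℓ 0 q) with hA0
  have hGs : ∀ ε, 0 < ε → MemLp (fun q => G ε (shearMap a ℓ (√ε) q)) 2 ν := fun ε hε =>
    (hG ε hε).comp_measurePreserving (measurePreserving_shearMap a ℓ _)
  have hFs : MemLp (fun q => F (shearMap a ℓ 0 q)) 2 ν :=
    (Lp.memLp F).comp_measurePreserving (measurePreserving_shearMap a ℓ _)
  have hAm : ∀ ε, 0 < ε → MemLp (A ε) 2 ν := fun ε hε =>
    (hGs ε hε).of_le (AEStronglyMeasurable.mul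
      (Continuous.aestronglyMeasurable (by fun_prop)) (hGs ε hε).1)
      (Eventually.of_forall fun q => by
        rw [norm_mul]
        exact mul_le_of_le_one_left (norm_nonneg _) (hκ1 ε hε.le _ _))
  have hA0m : MemLp A0 2 ν :=
    hFs.of_le (AEStronglyMeasurable.mul
      (Continuous.aestronglyMeasurable (by fun_prop)) hFs.1)
      (Eventually.of_forall fun q => by
        rw [norm_mul]
        exact mul_le_of_le_one_left (norm_nonneg _) (hκ1 0 le_rfl _ _))
  have hcore : Tendsto (fun ε => eLpNorm (fun q => G ε (shearMap a ℓ (√ε) q) -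
      F (shearMap a ℓ 0 q)) 2 ν) (𝓝[>] 0) (𝓝 0) := by
    -- Extension by zero to ε ≤ 0, so that every member of the family defines an element of L².
    set G' : ℝ → PhaseSpace N → ℂ := fun ε => if 0 < ε then G ε else 0 with hG'
    have hG'm : ∀ ε, MemLp (G' ε) 2 volume := fun ε => by
      by_cases h : 0 < ε
      · simpa [hG', h] using hG ε h
      · simp [hG', h]
    have ht : Tendsto (fun ε => (hG'm ε).toLp (G' ε)) (𝓝[>] 0) (𝓝 F) := by
      rw [Lp_tendsto_toLp_iff]
      refine hGF.congr' ?_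
      filter_upwards [self_mem_nhdsWithin] with ε hε
      simp [hG', Set.mem_Ioi.1 hε]
    have hs : Tendsto (fun ε => shearMap a ℓ (√ε)) (𝓝[>] 0) (𝓝 (shearMap a ℓ 0)) := by
      have h := ((continuous_shearMap a ℓ).comp Real.continuous_sqrt).tendsto 0
      simp only [Function.comp, Real.sqrt_zero] at h
      exact h.mono_left nhdsWithin_le_nhds
    -- Composition with measure preserving maps is jointly continuous: the L² functions and the
    -- shears may converge at the same time.
    have h := ht.compMeasurePreservingLp hs (fun ε => measurePreserving_shearMap a ℓ (√ε))
      (measurePreserving_shearMap a ℓ 0) (by norm_num)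
    simp only [Lp.toLp_compMeasurePreserving] at h
    rw [Lp_tendsto_toLp_iff] at h
    refine h.congr' ?_
    filter_upwards [self_mem_nhdsWithin] with ε hε
    refine eLpNorm_congr_ae ?_
    filter_upwards [Lp.coeFn_compMeasurePreserving F (measurePreserving_shearMap a ℓ 0)] with q hq
    rw [hq]
    simp [hG', Set.mem_Ioi.1 hε]
  have hdom : Tendsto (fun ε => eLpNorm (fun q => (κ ε q.2 (√ε • q.1) - κ 0 q.2 0) *
      F (shearMap a ℓ 0 q)) 2 ν) (𝓝[>] 0) (𝓝 0) := by
    refine tendsto_eLpNorm_two_of_dominated (F := fun q => 2 * F (shearMap a ℓ 0 q))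
      (hFs.const_mul 2) ?_ ?_ ?_
    · exact Eventually.of_forall fun ε => AEStronglyMeasurable.mul
        (Continuous.aestronglyMeasurable (by fun_prop)) hFs.1
    · filter_upwards [self_mem_nhdsWithin] with ε hε
      refine Eventually.of_forall fun q => ?_
      rw [norm_mul, norm_mul]
      gcongr
      refine (norm_sub_le _ _).trans ?_
      rw [Complex.norm_ofNat]
      linarith [hκ1 ε (le_of_lt hε) q.2 (√ε • q.1), hκ1 0 le_rfl q.2 0]
    · refine Eventually.of_forall fun q => ?_
      have hc : Continuous fun ε : ℝ => (κ ε q.2 (√ε • q.1) - κ 0 q.2 0) *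
          F (shearMap a ℓ 0 q) := by fun_prop
      have := hc.tendsto 0
      simp only [Real.sqrt_zero, zero_smul, sub_self, zero_mul] at this
      exact this.mono_left nhdsWithin_le_nhds
  -- The error is split into the change of the translated function, whose multiplier is bounded by
  -- one, and the change of the multiplier, treated by dominated convergence.
  have hD : Tendsto (fun ε => eLpNorm (fun q => A ε q - A0 q) 2 ν) (𝓝[>] 0) (𝓝 0) := by
    have hsum := hcore.add hdom
    rw [add_zero] at hsum
    refine tendsto_of_tendsto_of_tendsto_of_le_of_le' tendsto_const_nhds hsum
      (Eventually.of_forall fun ε => zero_le) ?_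
    filter_upwards [self_mem_nhdsWithin] with ε hε
    have hm1 : AEStronglyMeasurable (fun q : ConfSpace N × PhaseSpace N => κ ε q.2 (√ε • q.1) *
        (G ε (shearMap a ℓ (√ε) q) - F (shearMap a ℓ 0 q))) ν :=
      AEStronglyMeasurable.mul (Continuous.aestronglyMeasurable (by fun_prop))
        ((hGs ε hε).1.sub hFs.1)
    have hm2 : AEStronglyMeasurable (fun q : ConfSpace N × PhaseSpace N =>
        (κ ε q.2 (√ε • q.1) - κ 0 q.2 0) * F (shearMap a ℓ 0 q)) ν :=
      AEStronglyMeasurable.mul (Continuous.aestronglyMeasurable (by fun_prop)) hFs.1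
    have heq : (fun q => A ε q - A0 q) = (fun q : ConfSpace N × PhaseSpace N =>
        κ ε q.2 (√ε • q.1) * (G ε (shearMap a ℓ (√ε) q) - F (shearMap a ℓ 0 q))) +
        fun q => (κ ε q.2 (√ε • q.1) - κ 0 q.2 0) * F (shearMap a ℓ 0 q) := by
      ext q
      simp only [hA, hA0, Pi.add_apply]
      ring
    rw [heq]
    refine (eLpNorm_add_le hm1 hm2 (by norm_num)).trans ?_
    gcongr
    refine eLpNorm_mono fun q => ?_
    rw [norm_mul]
    exact mul_le_of_le_one_left (norm_nonneg _) (hκ1 ε (le_of_lt hε) _ _)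
  constructor
  · intro ε hε
    refine ⟨?_, (eLpNorm_two_integral_le (hAm ε hε).1).trans_lt (hAm ε hε).2⟩
    exact AEStronglyMeasurable.integral_prod_right' (hAm ε hε).1.prod_swap
  · refine tendsto_of_tendsto_of_tendsto_of_le_of_le' tendsto_const_nhds hD
      (Eventually.of_forall fun ε => zero_le) ?_
    filter_upwards [self_mem_nhdsWithin] with ε hε
    refine le_trans (le_of_eq (eLpNorm_congr_ae ?_))
      (eLpNorm_two_integral_le ((hAm ε hε).1.sub hA0m.1))
    filter_upwards [MemLp.ae_memLp_two_section (hAm ε hε)] with P hP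
    beta_reduce
    have hc : Integrable (fun w => A0 (w, P)) (heatMeasure N) := by
      simp only [hA0, shearMap, ContinuousMap.coe_mk, zero_smul]
      exact integrable_const _
    rw [integral_sub (hP.integrable (by norm_num)) hc]
    simp [hA, hA0, shearMap]

end GaussianAverage

/-! ### Integration over the momenta in the composition law. -/

section CompositionFormula

variable {N : ℕ}

/-- The phase factor `exp(-i Γ(a, b, c))` of the magnetic composition law. -/
def magneticPhase (B : MagneticField N) (a b c : ConfSpace N) : ℂ :=
  Complex.exp (-Complex.I * (B.flux a b c : ℂ))

theorem MagneticField.continuous_flux (B : MagneticField N) :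
    Continuous fun q : ConfSpace N × ConfSpace N × ConfSpace N => B.flux q.1 q.2.1 q.2.2 := by
  have hB := B.continuous_comp
  set g : ((ConfSpace N × ConfSpace N × ConfSpace N) × ℝ) → ℝ → ℝ := fun p t =>
    ∑ j, ∑ k, B.comp j k (p.1.1 + p.2 • (p.1.2.1 - p.1.1) + t • (p.1.2.2 - p.1.1)) *
      ((p.1.2.1 - p.1.1) j * (p.1.2.2 - p.1.1) k) with hg
  have hgc : Continuous (Function.uncurry g) := by
    simp only [hg, Function.uncurry_def]
    fun_prop
  have h1 : Continuous fun p : (ConfSpace N × ConfSpace N × ConfSpace N) × ℝ =>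
      ∫ t in (0 : ℝ)..(1 - p.2), g p t :=
    intervalIntegral.continuous_parametric_intervalIntegral_of_continuous hgc (by fun_prop)
  exact intervalIntegral.continuous_parametric_intervalIntegral_of_continuous'
    (f := fun q s => ∫ t in (0 : ℝ)..(1 - s), g (q, s) t) h1 0 1

@[fun_prop]
theorem Continuous.magneticPhase {α : Type*} [TopologicalSpace α] (B : MagneticField N)
    {a b c : α → ConfSpace N} (ha : Continuous a) (hb : Continuous b) (hc : Continuous c) :
    Continuous fun t => magneticPhase B (a t) (b t) (c t) := by
  have h : Continuous fun t => B.flux (a t) (b t) (c t) := by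
    have h2 := B.continuous_flux.comp (ha.prodMk (hb.prodMk hc))
    simpa only [Function.comp_def] using h2
  unfold _root_.magneticPhase
  fun_prop

theorem norm_exp_neg_I_mul_ofReal (t : ℝ) : ‖Complex.exp (-Complex.I * (t : ℂ))‖ = 1 := by
  rw [show -Complex.I * (t : ℂ) = ((-t : ℝ) : ℂ) * Complex.I by push_cast; ring]
  exact Complex.norm_exp_ofReal_mul_I _

theorem norm_magneticPhase (B : MagneticField N) (a b c : ConfSpace N) :
    ‖magneticPhase B a b c‖ = 1 :=
  norm_exp_neg_I_mul_ofReal _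

/-- The two momenta of integration never multiply each other, so for fixed positions the exponential
factorizes into one character in each. -/
theorem sympl_sub_sub (X Y Z : PhaseSpace N) :
    -2 * sympl (X - Y) (X - Z) = 2 * inner ℝ X.2 (Z.1 - Y.1) +
      inner ℝ ((2 : ℝ) • (X.1 - Z.1)) Y.2 + inner ℝ ((2 : ℝ) • (Y.1 - X.1)) Z.2 := by
  simp only [sympl, Prod.fst_sub, Prod.snd_sub, inner_sub_left, inner_sub_right,
    real_inner_smul_left, real_inner_comm X.2]
  ring

/-- The integrand of the magnetic composition law. -/
def compositionIntegrand (B : MagneticField N) (f g : PhaseSpace N → ℂ) (X : PhaseSpace N)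
    (Q : PhaseSpace N × PhaseSpace N) : ℂ :=
  Complex.exp (-2 * Complex.I * (sympl (X - Q.1) (X - Q.2) : ℂ)) *
    magneticPhase B (X.1 - Q.1.1 + Q.2.1) (Q.1.1 - Q.2.1 + X.1) (Q.2.1 - X.1 + Q.1.1) *
    f Q.1 * g Q.2

theorem integrable_compositionIntegrand (B : MagneticField N) {f g : PhaseSpace N → ℂ}
    (hf : Integrable f) (hg : Integrable g) (X : PhaseSpace N) :
    Integrable (compositionIntegrand B f g X)
      ((volume : Measure (PhaseSpace N)).prod (volume : Measure (PhaseSpace N))) := by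
  have h := (hf.mul_prod hg).bdd_mul (c := 1) (f := fun Q : PhaseSpace N × PhaseSpace N =>
    Complex.exp (-2 * Complex.I * (sympl (X - Q.1) (X - Q.2) : ℂ)) *
      magneticPhase B (X.1 - Q.1.1 + Q.2.1) (Q.1.1 - Q.2.1 + X.1) (Q.2.1 - X.1 + Q.1.1))
    (Continuous.aestronglyMeasurable (by unfold sympl; fun_prop))
    (Eventually.of_forall fun Q => by
      rw [norm_mul, norm_magneticPhase, mul_one,
        show -2 * Complex.I * (sympl (X - Q.1) (X - Q.2) : ℂ) =
          -Complex.I * ((2 * sympl (X - Q.1) (X - Q.2) : ℝ) : ℂ) by push_cast; ring]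
      exact (norm_exp_neg_I_mul_ofReal _).le)
  refine h.congr (Eventually.of_forall fun Q => ?_)
  simp only [compositionIntegrand]
  ring

/-- Exchange of the two middle variables. -/
def exchangeMiddle (q : (ConfSpace N × ConfSpace N) × (ConfSpace N × ConfSpace N)) :
    PhaseSpace N × PhaseSpace N :=
  ((q.1.1, q.2.1), (q.1.2, q.2.2))

theorem measurePreserving_exchangeMiddle :
    MeasurePreserving (exchangeMiddle (N := N))
      (((volume : Measure (ConfSpace N)).prod (volume : Measure (ConfSpace N))).prod
        ((volume : Measure (ConfSpace N)).prod (volume : Measure (ConfSpace N))))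
      (((volume : Measure (ConfSpace N)).prod (volume : Measure (ConfSpace N))).prod
        ((volume : Measure (ConfSpace N)).prod (volume : Measure (ConfSpace N)))) := by
  set μ := (volume : Measure (ConfSpace N))
  have h1 := measurePreserving_prodAssoc μ μ (μ.prod μ)
  have h2 := (MeasurePreserving.id μ).prod (measurePreserving_prodAssoc μ μ μ).symm
  have h3 := (MeasurePreserving.id μ).prod
    ((Measure.measurePreserving_swap (μ := μ) (ν := μ)).prod (MeasurePreserving.id μ))
  have h4 := (MeasurePreserving.id μ).prod (measurePreserving_prodAssoc μ μ μ)
  have h5 := (measurePreserving_prodAssoc μ μ (μ.prod μ)).symm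
  exact h5.comp (h4.comp (h3.comp (h2.comp h1)))

/-- The integrand of the magnetic composition law after integration over the momenta. -/
def reducedIntegrand (B : MagneticField N) (f g : PhaseSpace N → ℂ) (X : PhaseSpace N)
    (q : ConfSpace N × ConfSpace N) : ℂ :=
  Complex.exp (Complex.I * ((2 * inner ℝ X.2 (q.2 - q.1) : ℝ) : ℂ)) *
    magneticPhase B (X.1 - q.1 + q.2) (q.1 - q.2 + X.1) (q.2 - X.1 + q.1) *
    (partialFourier f (q.1, (2 : ℝ) • (X.1 - q.2)) * partialFourier g (q.2, (2 : ℝ) • (q.1 - X.1)))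

theorem integral_compositionIntegrand_momenta (B : MagneticField N) (f g : PhaseSpace N → ℂ)
    (X : PhaseSpace N) (q : ConfSpace N × ConfSpace N) :
    ∫ p, compositionIntegrand B f g X (exchangeMiddle (q, p))
      ∂((volume : Measure (ConfSpace N)).prod (volume : Measure (ConfSpace N))) =
    reducedIntegrand B f g X q := by
  simp only [reducedIntegrand, partialFourier, angularFourier]
  rw [← integral_prod_mul, ← integral_const_mul]
  congr 1 with p
  have h : Complex.exp (-2 * Complex.I * (sympl (X - (q.1, p.1)) (X - (q.2, p.2)) : ℂ)) =
      Complex.exp (Complex.I * ((2 * inner ℝ X.2 (q.2 - q.1) : ℝ) : ℂ)) *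
        (Complex.exp (Complex.I * (inner ℝ ((2 : ℝ) • (X.1 - q.2)) p.1 : ℝ)) *
        Complex.exp (Complex.I * (inner ℝ ((2 : ℝ) • (q.1 - X.1)) p.2 : ℝ))) := by
    rw [← Complex.exp_add, ← Complex.exp_add]
    congr 1
    have h2 := congrArg (fun t : ℝ => Complex.I * (t : ℂ))
      (sympl_sub_sub X (q.1, p.1) (q.2, p.2))
    simp only [Complex.ofReal_add] at h2
    rw [← mul_add, ← mul_add, ← add_assoc, ← h2]
    push_cast
    ring
  simp only [compositionIntegrand, exchangeMiddle, h]
  ring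

theorem integrable_reducedIntegrand (B : MagneticField N) {f g : PhaseSpace N → ℂ}
    (hf : Integrable f) (hg : Integrable g) (X : PhaseSpace N) :
    Integrable (reducedIntegrand B f g X)
      ((volume : Measure (ConfSpace N)).prod (volume : Measure (ConfSpace N))) := by
  have h := measurePreserving_exchangeMiddle.integrable_comp_of_integrable
    (integrable_compositionIntegrand B hf hg X)
  exact h.integral_prod_left.congr
    (Eventually.of_forall fun q => integral_compositionIntegrand_momenta B f g X q)

theorem magneticIntegral_eq_reduced (B : MagneticField N) {f g : PhaseSpace N → ℂ}
    (hf : Integrable f) (hg : Integrable g) (X : PhaseSpace N) :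
    magneticIntegral B f g X = ((Real.pi : ℂ) ^ (2 * N))⁻¹ *
      ∫ q, reducedIntegrand B f g X q
        ∂((volume : Measure (ConfSpace N)).prod (volume : Measure (ConfSpace N))) := by
  have hi := integrable_compositionIntegrand B hf hg X
  have h1 : magneticIntegral B f g X = ((Real.pi : ℂ) ^ (2 * N))⁻¹ *
      ∫ Q, compositionIntegrand B f g X Q
        ∂((volume : Measure (PhaseSpace N)).prod (volume : Measure (PhaseSpace N))) := by
    rw [integral_prod _ hi]
    rfl
  have h2 := measurePreserving_exchangeMiddle.integrable_comp_of_integrable hi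
  rw [h1]
  congr 1
  have hmap := integral_map (measurePreserving_exchangeMiddle (N := N)).measurable.aemeasurable
    (f := compositionIntegrand B f g X) (by
      rw [measurePreserving_exchangeMiddle.map_eq]
      exact hi.1)
  rw [measurePreserving_exchangeMiddle.map_eq] at hmap
  refine hmap.trans ?_
  have h3 := integral_prod _ h2
  refine h3.trans ?_
  exact integral_congr_ae
    (Eventually.of_forall fun q => integral_compositionIntegrand_momenta B f g X q)

end CompositionFormula

/-! ### Coordinates adapted to an exponential factor. -/

section ChangeOfVariables

variable {N : ℕ}

theorem map_affine_volume {c : ℝ} (hc : c ≠ 0) (b : ConfSpace N) :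
    Measure.map (fun v : ConfSpace N => b + c • v) volume =
      ENNReal.ofReal ((|c| ^ N)⁻¹) • (volume : Measure (ConfSpace N)) := by
  have h : (fun v : ConfSpace N => b + c • v) = (fun v => b + v) ∘ (fun v => c • v) := rfl
  rw [h, ← Measure.map_map (by fun_prop) (by fun_prop), Measure.map_addHaar_smul _ hc,
    Measure.map_smul, map_add_left_eq_self, finrank_euclideanSpace_fin, abs_inv, abs_pow]

/-- The change of variables `(v, w) ↦ (m, m + s v / 2)` with `m = x + s (x₀ - r w) / 2`. -/
def centerMap (s r : ℝ) (x x₀ : ConfSpace N) (q : ConfSpace N × ConfSpace N) :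
    ConfSpace N × ConfSpace N :=
  (x + (s / 2) • (x₀ - r • q.2), x + (s / 2) • (x₀ - r • q.2) + (s / 2) • q.1)

theorem measurable_centerMap (s r : ℝ) (x x₀ : ConfSpace N) :
    Measurable (centerMap s r x x₀) := by
  unfold centerMap
  fun_prop

/-- The Jacobian is (1/2)^N from v times (r/2)^N from w; the pushforward has the inverse as its
density. -/
theorem map_centerMap {s r : ℝ} (hs : |s| = 1) (hr : 0 < r) (x x₀ : ConfSpace N) :
    Measure.map (centerMap s r x x₀)
      ((volume : Measure (ConfSpace N)).prod (volume : Measure (ConfSpace N))) =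
      ENNReal.ofReal (4 ^ N * (r ^ N)⁻¹) •
        (volume : Measure (ConfSpace N)).prod (volume : Measure (ConfSpace N)) := by
  have hs0 : s ≠ 0 := fun h => by simp [h] at hs
  have h1 : MeasurePreserving (fun q : ConfSpace N × ConfSpace N => (q.2, q.2 + q.1))
      ((volume : Measure (ConfSpace N)).prod volume) (volume.prod volume) :=
    (measurePreserving_prod_add volume volume).comp Measure.measurePreserving_swap
  have h2 : centerMap s r x x₀ = (fun q : ConfSpace N × ConfSpace N => (q.2, q.2 + q.1)) ∘
      Prod.map (fun v => 0 + (s / 2) • v)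
        (fun w => (x + (s / 2) • x₀) + (-(s / 2 * r)) • w) := by
    ext q : 1
    simp only [centerMap, Function.comp, Prod.map]
    congr 1 <;> module
  rw [h2, ← Measure.map_map h1.measurable (by fun_prop),
    ← Measure.map_prod_map _ _ (by fun_prop) (by fun_prop),
    map_affine_volume (by positivity), map_affine_volume (by simp [hs0, hr.ne']),
    Measure.prod_smul_left, Measure.prod_smul_right, Measure.map_smul, Measure.map_smul, h1.map_eq,
    smul_smul, ← ENNReal.ofReal_mul (by positivity)]
  congr 2
  rw [abs_neg, abs_mul, abs_div, hs, abs_of_pos hr, ← mul_inv, ← mul_pow, inv_eq_iff_eq_inv,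
    mul_inv, inv_inv, ← inv_pow, ← mul_pow]
  norm_num
  ring

theorem integrable_comp_centerMap {s r : ℝ} (hs : |s| = 1) (hr : 0 < r) (x x₀ : ConfSpace N)
    {k : ConfSpace N × ConfSpace N → ℂ}
    (hk : Integrable k ((volume : Measure (ConfSpace N)).prod volume)) :
    Integrable (fun q => k (centerMap s r x x₀ q))
      ((volume : Measure (ConfSpace N)).prod volume) := by
  refine Integrable.comp_measurable (f := centerMap s r x x₀) ?_ (measurable_centerMap s r x x₀)
  rw [map_centerMap hs hr]
  exact hk.smul_measure ENNReal.ofReal_ne_top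

theorem integral_comp_centerMap {s r : ℝ} (hs : |s| = 1) (hr : 0 < r) (x x₀ : ConfSpace N)
    {k : ConfSpace N × ConfSpace N → ℂ}
    (hk : Integrable k ((volume : Measure (ConfSpace N)).prod volume)) :
    ∫ q, k q ∂((volume : Measure (ConfSpace N)).prod volume) =
      (((4 ^ N)⁻¹ * r ^ N : ℝ) : ℂ) *
        ∫ v : ConfSpace N, ∫ w : ConfSpace N, k (centerMap s r x x₀ (v, w)) := by
  have h := integral_map (measurable_centerMap s r x x₀).aemeasurable
    (μ := (volume : Measure (ConfSpace N)).prod volume) (f := k) (by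
      rw [map_centerMap hs hr]
      exact hk.1.smul_measure _)
  rw [map_centerMap hs hr, integral_smul_measure, ENNReal.toReal_ofReal (by positivity)] at h
  have h2 := integral_prod _ (integrable_comp_centerMap hs hr x x₀ hk)
  rw [← h2, ← h, Complex.real_smul, ← mul_assoc, ← Complex.ofReal_mul]
  have : (4 ^ N : ℝ)⁻¹ * r ^ N * (4 ^ N * (r ^ N)⁻¹) = 1 := by
    have := hr.ne'
    field_simp
  rw [this, Complex.ofReal_one, one_mul]

end ChangeOfVariables

/-! ### Twisted translations: multiplication by an exponential after partial Fourier transform. -/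

section Twist

variable {N : ℕ}

/-- The multiplier occurring in the magnetic product with `χ_ε 𝔢_{X₀}`, on the left for `s = 1`
and on the right for `s = -1`. -/
def twistKernel (B : MagneticField N) (s : ℝ) (X₀ : PhaseSpace N) (ε : ℝ) (P : PhaseSpace N)
    (w : ConfSpace N) : ℂ :=
  magneticPhase B (P.1 - (1 / 2 : ℝ) • P.2) (P.1 + (1 / 2 : ℝ) • P.2)
      (P.1 + (s / 2) • P.2 + s • (X₀.1 - w)) *
    ((Real.exp (-ε * ‖P.1 + (s / 2) • P.2 + (s / 2) • (X₀.1 - w)‖ ^ 2) : ℂ) *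
      Complex.exp (-Complex.I *
        ((inner ℝ (P.1 + (s / 2) • P.2 + (s / 2) • (X₀.1 - w)) X₀.2 : ℝ) : ℂ)))

theorem continuous_twistKernel (B : MagneticField N) (s : ℝ) (X₀ : PhaseSpace N) :
    Continuous fun q : ℝ × PhaseSpace N × ConfSpace N =>
      twistKernel B s X₀ q.1 q.2.1 q.2.2 := by
  unfold twistKernel
  fun_prop

theorem norm_twistKernel (B : MagneticField N) (s : ℝ) (X₀ : PhaseSpace N) (ε : ℝ)
    (P : PhaseSpace N) (w : ConfSpace N) : ‖twistKernel B s X₀ ε P w‖ =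
      Real.exp (-ε * ‖P.1 + (s / 2) • P.2 + (s / 2) • (X₀.1 - w)‖ ^ 2) := by
  rw [twistKernel, norm_mul, norm_mul, norm_magneticPhase, norm_exp_neg_I_mul_ofReal,
    Complex.norm_real, Real.norm_eq_abs, Real.abs_exp, one_mul, mul_one]

theorem norm_twistKernel_le (B : MagneticField N) (s : ℝ) (X₀ : PhaseSpace N) {ε : ℝ} (hε : 0 ≤ ε)
    (P : PhaseSpace N) (w : ConfSpace N) : ‖twistKernel B s X₀ ε P w‖ ≤ 1 := by
  rw [norm_twistKernel, Real.exp_le_one_iff, neg_mul, Left.neg_nonpos_iff]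
  positivity

/-- The translation of phase space accompanying the multiplier `twistKernel`. -/
def twistShift (s : ℝ) (X₀ : PhaseSpace N) : PhaseSpace N := ((s / 2) • X₀.1, X₀.1)

theorem measurePreserving_add_phaseSpace (a : PhaseSpace N) :
    MeasurePreserving (fun P : PhaseSpace N => P + a) volume volume :=
  measurePreserving_add_right ((volume : Measure (ConfSpace N)).prod volume) a

theorem continuous_twistKernel_zero (B : MagneticField N) (s : ℝ) (X₀ : PhaseSpace N) :
    Continuous fun P : PhaseSpace N => twistKernel B s X₀ 0 P 0 :=
  (continuous_twistKernel B s X₀).comp (g := fun q : ℝ × PhaseSpace N × ConfSpace N =>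
    twistKernel B s X₀ q.1 q.2.1 q.2.2) (f := fun P : PhaseSpace N => (0, P, 0)) (by fun_prop)

theorem memLp_twist (B : MagneticField N) (s : ℝ) (X₀ : PhaseSpace N) (F : PhaseLp N) :
    MemLp (fun P => twistKernel B s X₀ 0 P 0 * F (P + twistShift s X₀)) 2 volume := by
  have h := (Lp.memLp F).comp_measurePreserving
    (measurePreserving_add_phaseSpace (twistShift s X₀))
  refine h.of_le (AEStronglyMeasurable.mul
    (continuous_twistKernel_zero B s X₀).aestronglyMeasurable h.1) ?_
  refine Eventually.of_forall fun P => ?_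
  rw [norm_mul]
  exact mul_le_of_le_one_left (norm_nonneg _) (norm_twistKernel_le B s X₀ le_rfl P 0)

/-- The partial Fourier transform of the magnetic multiplication by `𝔢_{X₀}`, from the left for
`s = 1` and from the right for `s = -1`. -/
def twistL (B : MagneticField N) (s : ℝ) (X₀ : PhaseSpace N) (F : PhaseLp N) : PhaseLp N :=
  (memLp_twist B s X₀ F).toLp _

theorem twistL_ae_eq (B : MagneticField N) (s : ℝ) (X₀ : PhaseSpace N) (F : PhaseLp N) :
    twistL B s X₀ F =ᵐ[volume]
      fun P => twistKernel B s X₀ 0 P 0 * F (P + twistShift s X₀) :=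
  MemLp.coeFn_toLp (memLp_twist B s X₀ F)

end Twist

/-! ### The Gaussian kernel of a regularized exponential. -/

section MagneticTranslations

variable {N : ℕ}

theorem integrable_gaussCutoff_phaseExp {ε : ℝ} (hε : 0 < ε) (X₀ : PhaseSpace N) :
    Integrable (gaussCutoff ε (phaseExp X₀)) := by
  have h := (integrable_gaussWeight (N := N) hε).ofReal (𝕜 := ℂ)
  refine (h.mul_bdd (c := 1) (g := phaseExp X₀)
    (Continuous.aestronglyMeasurable (by unfold phaseExp sympl; fun_prop))
    (Eventually.of_forall fun Z => (norm_exp_neg_I_mul_ofReal _).le))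

/-- The cut-off exponential has a Gaussian of width √ε around -x₀ as its transform. Measuring the
deviation from -x₀ in units of √ε gives a profile in w free of ε, which is the heat kernel up to a
constant. -/
theorem partialFourier_gaussCutoff_phaseExp {ε : ℝ} (hε : 0 < ε) (X₀ : PhaseSpace N)
    (o w : ConfSpace N) :
    partialFourier (gaussCutoff ε (phaseExp X₀)) (o, -(X₀.1 - √ε • w)) =
      ((√(Real.pi / ε) ^ N : ℝ) : ℂ) * (Real.exp (-(1 / 4) * ‖w‖ ^ 2) : ℂ) *
        ((Real.exp (-ε * ‖o‖ ^ 2) : ℂ) *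
          Complex.exp (-Complex.I * ((inner ℝ o X₀.2 : ℝ) : ℂ))) := by
  have h1 : ∀ ζ : ConfSpace N,
      Complex.exp (Complex.I * (inner ℝ (-(X₀.1 - √ε • w)) ζ : ℝ)) *
        gaussCutoff ε (phaseExp X₀) (o, ζ) =
      ((Real.exp (-ε * ‖o‖ ^ 2) : ℂ) *
          Complex.exp (-Complex.I * ((inner ℝ o X₀.2 : ℝ) : ℂ))) *
        Complex.exp (-(ε : ℂ) * ‖ζ‖ ^ 2 + (Complex.I * √ε) * (inner ℝ w ζ : ℝ)) := by
    intro ζ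
    simp only [gaussCutoff, phaseExp, sympl, Complex.ofReal_exp, ← Complex.exp_add]
    congr 1
    simp only [neg_sub, inner_sub_left, real_inner_smul_left]
    push_cast
    ring
  simp only [partialFourier, angularFourier, h1]
  rw [integral_const_mul, GaussianFourier.integral_cexp_neg_mul_sq_norm_add (by simpa using hε),
    finrank_euclideanSpace_fin, ← Complex.ofReal_div, cpow_half_nat (by positivity)]
  have h2 : ((Complex.I * √ε) ^ 2 * ‖w‖ ^ 2 / (4 * ε) : ℂ) = ((-(1 / 4) * ‖w‖ ^ 2 : ℝ) : ℂ) := by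
    have h3 : ((√ε : ℝ) : ℂ) ^ 2 = ε := by rw [← Complex.ofReal_pow, Real.sq_sqrt hε.le]
    have h4 : (ε : ℂ) ≠ 0 := by exact_mod_cast hε.ne'
    rw [mul_pow, h3, Complex.I_sq]
    push_cast
    field_simp
  rw [h2, ← Complex.ofReal_exp]
  ring

/-- The second component of the shift in the Gaussian average. -/
def twistDirection (N : ℕ) (s : ℝ) : ConfSpace N →L[ℝ] PhaseSpace N :=
  ((s / 2) • ContinuousLinearMap.id ℝ _).prod (ContinuousLinearMap.id ℝ _)

/-- The Gaussian average approximating `twistL`. -/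
def gaussTwist (B : MagneticField N) (s : ℝ) (X₀ : PhaseSpace N) (ε : ℝ) (G : PhaseSpace N → ℂ)
    (P : PhaseSpace N) : ℂ :=
  ∫ w, twistKernel B s X₀ ε P (√ε • w) *
    G (P + twistShift s X₀ - √ε • twistDirection N s w) ∂heatMeasure N

/-- The prefactor of the composition law, the Jacobian of `centerMap` with r = √ε and the Gaussian
mass combine into the constant of Fourier inversion times that of the heat kernel; all powers of ε
cancel. -/
theorem gauss_constant {ε : ℝ} (hε : 0 < ε) (N : ℕ) :
    (Real.pi ^ (2 * N))⁻¹ * ((4 ^ N)⁻¹ * √ε ^ N) * √(Real.pi / ε) ^ N =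
      ((2 * Real.pi) ^ N)⁻¹ * ((2 * √Real.pi) ^ N)⁻¹ := by
  have h1 : √ε ^ N * √(Real.pi / ε) ^ N = √Real.pi ^ N := by
    rw [← mul_pow, ← Real.sqrt_mul hε.le, mul_div_cancel₀ _ hε.ne']
  have h2 : √Real.pi ^ N * √Real.pi ^ N = Real.pi ^ N := by
    rw [← mul_pow, Real.mul_self_sqrt Real.pi_pos.le]
  have h3 : Real.pi ≠ 0 := Real.pi_ne_zero
  have h4 : √Real.pi ≠ 0 := (Real.sqrt_pos.2 Real.pi_pos).ne'
  have h5 : (4 : ℝ) ^ N = 2 ^ N * 2 ^ N := by rw [← mul_pow]; norm_num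
  calc _ = (Real.pi ^ (2 * N))⁻¹ * (4 ^ N)⁻¹ * (√ε ^ N * √(Real.pi / ε) ^ N) := by ring
    _ = (Real.pi ^ (2 * N))⁻¹ * (4 ^ N)⁻¹ * √Real.pi ^ N := by rw [h1]
    _ = _ := by
      rw [mul_pow, mul_pow, pow_mul', sq, h5, ← h2]
      field_simp

end MagneticTranslations

/-! ### Magnetic products with exponentials as limits of Gaussian averages. -/

section MagneticTranslations

variable {N : ℕ}

/-- The value of the reduced composition integrand after the change of variables `centerMap`. -/
def centeredIntegrand (B : MagneticField N) (s : ℝ) (X₀ : PhaseSpace N) (ε : ℝ)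
    (G : PhaseSpace N → ℂ) (X : PhaseSpace N) (v w : ConfSpace N) : ℂ :=
  Complex.exp (Complex.I * (inner ℝ (-X.2) v : ℝ)) *
    (((√(Real.pi / ε) ^ N : ℝ) : ℂ) * (Real.exp (-(1 / 4) * ‖w‖ ^ 2) : ℂ)) *
    (twistKernel B s X₀ ε (X.1, v) (√ε • w) *
      G ((X.1, v) + twistShift s X₀ - √ε • twistDirection N s w))

/-- The midpoint m of `centerMap` is chosen so that 2(x - m) is the argument -(x₀ - √ε w) of the
Gaussian. Then the character becomes exp(-i ξ·v), the kernel of the inverse transform, and the flux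
triangle starts with the edge from x - v/2 to x + v/2. The swap is needed because here m is the
position of the second factor. -/
theorem reducedIntegrand_left (B : MagneticField N) {ε : ℝ} (hε : 0 < ε) (X₀ : PhaseSpace N)
    (g : PhaseSpace N → ℂ) (X : PhaseSpace N) (v w : ConfSpace N) :
    reducedIntegrand B (gaussCutoff ε (phaseExp X₀)) g X
        (centerMap 1 (√ε) X.1 X₀.1 (v, w)).swap =
      centeredIntegrand B 1 X₀ ε (partialFourier g) X v w := by
  simp only [reducedIntegrand, centerMap, Prod.swap, centeredIntegrand, twistKernel]
  rw [show (2 : ℝ) • (X.1 - (X.1 + (1 / 2 : ℝ) • (X₀.1 - √ε • w))) = -(X₀.1 - √ε • w) by module,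
    partialFourier_gaussCutoff_phaseExp hε]
  have e1 : X.1 - (X.1 + (1 / 2 : ℝ) • (X₀.1 - √ε • w) + (1 / 2 : ℝ) • v) +
      (X.1 + (1 / 2 : ℝ) • (X₀.1 - √ε • w)) = X.1 - (1 / 2 : ℝ) • v := by module
  have e2 : X.1 + (1 / 2 : ℝ) • (X₀.1 - √ε • w) + (1 / 2 : ℝ) • v -
      (X.1 + (1 / 2 : ℝ) • (X₀.1 - √ε • w)) + X.1 = X.1 + (1 / 2 : ℝ) • v := by module
  have e3 : X.1 + (1 / 2 : ℝ) • (X₀.1 - √ε • w) - X.1 +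
      (X.1 + (1 / 2 : ℝ) • (X₀.1 - √ε • w) + (1 / 2 : ℝ) • v) =
      X.1 + (1 / 2 : ℝ) • v + (1 : ℝ) • (X₀.1 - √ε • w) := by module
  have e4 : 2 * inner ℝ X.2 (X.1 + (1 / 2 : ℝ) • (X₀.1 - √ε • w) -
      (X.1 + (1 / 2 : ℝ) • (X₀.1 - √ε • w) + (1 / 2 : ℝ) • v)) = inner ℝ (-X.2) v := by
    rw [show X.1 + (1 / 2 : ℝ) • (X₀.1 - √ε • w) -
      (X.1 + (1 / 2 : ℝ) • (X₀.1 - √ε • w) + (1 / 2 : ℝ) • v) = (-(1 / 2) : ℝ) • v by module,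
      real_inner_smul_right, inner_neg_left]
    ring
  have e5 : ((X.1 + (1 / 2 : ℝ) • (X₀.1 - √ε • w),
      (2 : ℝ) • (X.1 + (1 / 2 : ℝ) • (X₀.1 - √ε • w) + (1 / 2 : ℝ) • v - X.1)) : PhaseSpace N) =
      (X.1, v) + twistShift 1 X₀ - √ε • twistDirection N 1 w := by
    simp only [twistShift, twistDirection, ContinuousLinearMap.prod_apply,
      _root_.smul_apply, ContinuousLinearMap.id_apply, Prod.smul_mk, Prod.mk_add_mk,
      Prod.mk_sub_mk, Prod.mk.injEq]
    exact ⟨by module, by module⟩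
  have e6 : X.1 + (1 / 2 : ℝ) • (X₀.1 - √ε • w) + (1 / 2 : ℝ) • v =
      X.1 + (1 / 2 : ℝ) • v + (1 / 2 : ℝ) • (X₀.1 - √ε • w) := by module
  rw [e1, e2, e3, e4, e5, e6]
  ring

theorem reducedIntegrand_right (B : MagneticField N) {ε : ℝ} (hε : 0 < ε) (X₀ : PhaseSpace N)
    (f : PhaseSpace N → ℂ) (X : PhaseSpace N) (v w : ConfSpace N) :
    reducedIntegrand B f (gaussCutoff ε (phaseExp X₀)) X
        (centerMap (-1) (√ε) X.1 X₀.1 (v, w)) =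
      centeredIntegrand B (-1) X₀ ε (partialFourier f) X v w := by
  simp only [reducedIntegrand, centerMap, centeredIntegrand, twistKernel]
  rw [show (2 : ℝ) • ((X.1 + (-1 / 2 : ℝ) • (X₀.1 - √ε • w)) - X.1) = -(X₀.1 - √ε • w) by module,
    partialFourier_gaussCutoff_phaseExp hε]
  have e1 : X.1 - (X.1 + (-1 / 2 : ℝ) • (X₀.1 - √ε • w)) +
      (X.1 + (-1 / 2 : ℝ) • (X₀.1 - √ε • w) + (-1 / 2 : ℝ) • v) = X.1 - (1 / 2 : ℝ) • v := by module
  have e2 : X.1 + (-1 / 2 : ℝ) • (X₀.1 - √ε • w) -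
      (X.1 + (-1 / 2 : ℝ) • (X₀.1 - √ε • w) + (-1 / 2 : ℝ) • v) + X.1 =
      X.1 + (1 / 2 : ℝ) • v := by module
  have e3 : X.1 + (-1 / 2 : ℝ) • (X₀.1 - √ε • w) + (-1 / 2 : ℝ) • v - X.1 +
      (X.1 + (-1 / 2 : ℝ) • (X₀.1 - √ε • w)) =
      X.1 + (-1 / 2 : ℝ) • v + (-1 : ℝ) • (X₀.1 - √ε • w) := by module
  have e4 : 2 * inner ℝ X.2 (X.1 + (-1 / 2 : ℝ) • (X₀.1 - √ε • w) + (-1 / 2 : ℝ) • v -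
      (X.1 + (-1 / 2 : ℝ) • (X₀.1 - √ε • w))) = inner ℝ (-X.2) v := by
    rw [show X.1 + (-1 / 2 : ℝ) • (X₀.1 - √ε • w) + (-1 / 2 : ℝ) • v -
      (X.1 + (-1 / 2 : ℝ) • (X₀.1 - √ε • w)) = (-(1 / 2) : ℝ) • v by module,
      real_inner_smul_right, inner_neg_left]
    ring
  have e5 : ((X.1 + (-1 / 2 : ℝ) • (X₀.1 - √ε • w), (2 : ℝ) •
      (X.1 - (X.1 + (-1 / 2 : ℝ) • (X₀.1 - √ε • w) + (-1 / 2 : ℝ) • v))) : PhaseSpace N) =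
      (X.1, v) + twistShift (-1) X₀ - √ε • twistDirection N (-1) w := by
    simp only [twistShift, twistDirection, ContinuousLinearMap.prod_apply,
      _root_.smul_apply, ContinuousLinearMap.id_apply, Prod.smul_mk, Prod.mk_add_mk,
      Prod.mk_sub_mk, Prod.mk.injEq]
    exact ⟨by module, by module⟩
  have e6 : X.1 + (-1 / 2 : ℝ) • (X₀.1 - √ε • w) + (-1 / 2 : ℝ) • v =
      X.1 + (-1 / 2 : ℝ) • v + (-1 / 2 : ℝ) • (X₀.1 - √ε • w) := by module
  rw [e1, e2, e3, e4, e5, e6]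
  ring

theorem integral_centeredIntegrand (B : MagneticField N) (s : ℝ) (X₀ : PhaseSpace N) (ε : ℝ)
    (G : PhaseSpace N → ℂ) (X : PhaseSpace N) (v : ConfSpace N) :
    ∫ w, centeredIntegrand B s X₀ ε G X v w =
      ((√(Real.pi / ε) ^ N * (2 * √Real.pi) ^ N : ℝ) : ℂ) *
        (Complex.exp (Complex.I * (inner ℝ (-X.2) v : ℝ)) * gaussTwist B s X₀ ε G (X.1, v)) := by
  rw [gaussTwist, integral_heatMeasure, ← integral_const_mul, ← integral_const_mul]
  congr 1 with w
  have h : (2 * √Real.pi) ^ N ≠ 0 := by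
    have := Real.pi_pos
    positivity
  have h2 : (Real.exp (-(1 / 4) * ‖w‖ ^ 2) : ℂ) =
      (((2 * √Real.pi) ^ N : ℝ) : ℂ) * (heatDensity w : ℂ) := by
    rw [← Complex.ofReal_mul, heatDensity, mul_inv_cancel_left₀ h]
  rw [centeredIntegrand, h2]
  push_cast
  ring

/-- At momentum zero the character is trivial, so Fubini for the reduced integrand gives
integrability on every fibre, not merely almost every one. -/
theorem integrable_gaussTwist (B : MagneticField N) {s : ℝ} (hs : |s| = 1) (X₀ : PhaseSpace N)
    {ε : ℝ} (hε : 0 < ε) {G : PhaseSpace N → ℂ} {k : ConfSpace N × ConfSpace N → ℂ} (x : ConfSpace N)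
    (hk : Integrable k ((volume : Measure (ConfSpace N)).prod volume))
    (h : ∀ v w, k (centerMap s (√ε) x X₀.1 (v, w)) = centeredIntegrand B s X₀ ε G (x, 0) v w) :
    Integrable fun v => gaussTwist B s X₀ ε G (x, v) := by
  have h1 := (integrable_comp_centerMap hs (Real.sqrt_pos.2 hε) x X₀.1 hk).integral_prod_left
  simp only [h, integral_centeredIntegrand] at h1
  have hc : ((√(Real.pi / ε) ^ N * (2 * √Real.pi) ^ N : ℝ) : ℂ) ≠ 0 := by
    have := Real.pi_pos
    exact_mod_cast (by positivity : (√(Real.pi / ε) ^ N * (2 * √Real.pi) ^ N : ℝ) ≠ 0)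
  refine (h1.const_mul ((√(Real.pi / ε) ^ N * (2 * √Real.pi) ^ N : ℝ) : ℂ)⁻¹).congr
    (Eventually.of_forall fun v => ?_)
  simp only [neg_zero, inner_zero_left, Complex.ofReal_zero, mul_zero, Complex.exp_zero, one_mul]
  rw [inv_mul_cancel_left₀ hc]

theorem integral_eq_partialFourier_gaussTwist (B : MagneticField N) {s : ℝ} (hs : |s| = 1)
    (X₀ : PhaseSpace N) {ε : ℝ} (hε : 0 < ε) {G : PhaseSpace N → ℂ}
    {k : ConfSpace N × ConfSpace N → ℂ} (X : PhaseSpace N)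
    (hk : Integrable k ((volume : Measure (ConfSpace N)).prod volume))
    (h : ∀ v w, k (centerMap s (√ε) X.1 X₀.1 (v, w)) = centeredIntegrand B s X₀ ε G X v w) :
    ((Real.pi : ℂ) ^ (2 * N))⁻¹ * ∫ q, k q ∂((volume : Measure (ConfSpace N)).prod volume) =
      ((((2 * Real.pi) ^ N)⁻¹ : ℝ) : ℂ) *
        partialFourier (gaussTwist B s X₀ ε G) (reflectSnd X) := by
  rw [integral_comp_centerMap hs (Real.sqrt_pos.2 hε) X.1 X₀.1 hk]
  simp only [h, integral_centeredIntegrand]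
  rw [integral_const_mul, ← mul_assoc, ← mul_assoc]
  congr 1
  have h2 : (2 * √Real.pi) ^ N ≠ 0 := by
    have := Real.pi_pos
    positivity
  have h3 := congrArg (fun t : ℝ => ((t * (2 * √Real.pi) ^ N : ℝ) : ℂ)) (gauss_constant hε N)
  simp only [inv_mul_cancel_right₀ h2] at h3
  rw [← h3]
  push_cast
  ring

/-- The regularized product is the inverse partial transform of a Gaussian average. The average
converges in L² to `twistL`, and the inverse transform multiplies distances by a constant, so the
products converge. -/
theorem isMagneticProduct_of_gaussTwist (B : MagneticField N) (s : ℝ) (X₀ : PhaseSpace N)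
    (u : PhaseLp N) {f g : PhaseSpace N → ℂ}
    (hfi : ∀ ε, 0 < ε → ∀ x, Integrable fun v =>
      gaussTwist B s X₀ ε (partialFourier (gaussCutoff ε u)) (x, v))
    (h : ∀ ε, 0 < ε → ∀ X, magneticIntegral B (gaussCutoff ε f) (gaussCutoff ε g) X =
      ((((2 * Real.pi) ^ N)⁻¹ : ℝ) : ℂ) * partialFourier
        (gaussTwist B s X₀ ε (partialFourier (gaussCutoff ε u))) (reflectSnd X)) :
    IsMagneticProduct B f g (partialFourierInvL (twistL B s X₀ (partialFourierL N u))) := by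
  refine ⟨Lp.memLp _, ?_⟩
  have hu : ∀ ε, 0 < ε → MemLp (gaussCutoff ε u) 2 volume := fun ε hε =>
    memLp_gaussCutoff hε.le (Lp.memLp u)
  have hui : ∀ ε, 0 < ε → FiberIntegrable (gaussCutoff ε u) := fun ε hε =>
    FiberIntegrable.of_integrable (integrable_gaussCutoff hε (Lp.memLp u))
  have hlim : Tendsto (fun ε => eLpNorm (fun P => partialFourier (gaussCutoff ε u) P -
      partialFourierL N u P) 2 volume) (𝓝[>] 0) (𝓝 0) := by
    have h1 := ENNReal.Tendsto.const_mul (a := ENNReal.ofReal (fourierConst N))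
      (tendsto_gaussCutoff (Lp.memLp u)) (Or.inr ENNReal.ofReal_ne_top)
    rw [mul_zero] at h1
    refine h1.congr' ?_
    filter_upwards [self_mem_nhdsWithin] with ε hε
    have e1 : eLpNorm (fun X => gaussCutoff ε u X - u X) 2 volume = ‖(hu ε hε).toLp _ - u‖ₑ := by
      rw [Lp.enorm_def]
      refine eLpNorm_congr_ae ?_
      filter_upwards [Lp.coeFn_sub ((hu ε hε).toLp _) u, (hu ε hε).coeFn_toLp] with X h1 h2
      rw [h1, Pi.sub_apply, h2]
    have e2 : eLpNorm (fun P => partialFourier (gaussCutoff ε u) P -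
        partialFourierL N u P) 2 volume = ‖partialFourierL N ((hu ε hε).toLp _ - u)‖ₑ := by
      rw [Lp.enorm_def, map_sub, partialFourierL_toLp (hu ε hε) (hui ε hε)]
      refine eLpNorm_congr_ae ?_
      filter_upwards [Lp.coeFn_sub ((memLp_partialFourier (hu ε hε) (hui ε hε)).toLp _)
        (partialFourierL N u), (memLp_partialFourier (hu ε hε) (hui ε hε)).coeFn_toLp] with X h1 h2
      rw [h1, Pi.sub_apply, h2]
    rw [e1, e2, ← ofReal_norm, ← ofReal_norm, norm_partialFourierL,
      ENNReal.ofReal_mul (fourierConst_pos N).le]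
  obtain ⟨hm, ht⟩ := gaussian_average_tendsto
    (fun ε hε => memLp_partialFourier (hu ε hε) (hui ε hε)) hlim (continuous_twistKernel B s X₀)
    (fun ε hε P w => norm_twistKernel_le B s X₀ hε P w) (twistShift s X₀) (twistDirection N s)
  have h2 := ENNReal.Tendsto.const_mul (a := ENNReal.ofReal (fourierConst N)⁻¹) ht
    (Or.inr ENNReal.ofReal_ne_top)
  rw [mul_zero] at h2
  refine h2.congr' ?_
  filter_upwards [self_mem_nhdsWithin] with ε hε
  have hQ : MemLp (gaussTwist B s X₀ ε (partialFourier (gaussCutoff ε u))) 2 volume := hm ε hε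
  have hQi : FiberIntegrable (gaussTwist B s X₀ ε (partialFourier (gaussCutoff ε u))) :=
    Eventually.of_forall (hfi ε hε)
  have e1 : eLpNorm (fun P => gaussTwist B s X₀ ε (partialFourier (gaussCutoff ε u)) P -
      twistKernel B s X₀ 0 P 0 * partialFourierL N u (P + twistShift s X₀)) 2 volume =
      ‖hQ.toLp _ - twistL B s X₀ (partialFourierL N u)‖ₑ := by
    rw [Lp.enorm_def]
    refine eLpNorm_congr_ae ?_
    filter_upwards [Lp.coeFn_sub (hQ.toLp _) (twistL B s X₀ (partialFourierL N u)),
      hQ.coeFn_toLp, twistL_ae_eq B s X₀ (partialFourierL N u)] with X h1 h2 h3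
    rw [h1, Pi.sub_apply, h2, h3]
  have e2 : eLpNorm (fun X => magneticIntegral B (gaussCutoff ε f) (gaussCutoff ε g) X -
      partialFourierInvL (twistL B s X₀ (partialFourierL N u)) X) 2 volume =
      ‖partialFourierInvL (hQ.toLp _ - twistL B s X₀ (partialFourierL N u))‖ₑ := by
    rw [Lp.enorm_def, partialFourierInvL_sub]
    refine eLpNorm_congr_ae ?_
    filter_upwards [Lp.coeFn_sub (partialFourierInvL (hQ.toLp _))
      (partialFourierInvL (twistL B s X₀ (partialFourierL N u))),
      partialFourierInvL_ae_eq hQ hQi] with X h1 h2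
    rw [h1, Pi.sub_apply, h2, h ε hε]
  refine Eq.trans ?_ e2.symm
  refine (congrArg (ENNReal.ofReal (fourierConst N)⁻¹ * ·) e1).trans ?_
  rw [← ofReal_norm, ← ofReal_norm, norm_partialFourierInvL,
    ENNReal.ofReal_mul (inv_nonneg.2 (fourierConst_pos N).le)]

/-- The magnetic product `𝔢_{X₀} #^B u`. -/
theorem isMagneticProduct_phaseExp_left (B : MagneticField N) (X₀ : PhaseSpace N) (u : PhaseLp N) :
    IsMagneticProduct B (phaseExp X₀) u
      (partialFourierInvL (twistL B 1 X₀ (partialFourierL N u))) := by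
  have hi : ∀ ε, 0 < ε → ∀ X, Integrable (fun q => reducedIntegrand B (gaussCutoff ε (phaseExp X₀))
      (gaussCutoff ε u) X q.swap) ((volume : Measure (ConfSpace N)).prod volume) := fun ε hε X =>
    (integrable_reducedIntegrand B (integrable_gaussCutoff_phaseExp hε X₀)
      (integrable_gaussCutoff hε (Lp.memLp u)) X).swap
  refine isMagneticProduct_of_gaussTwist B 1 X₀ u (fun ε hε x => ?_) fun ε hε X => ?_
  · exact integrable_gaussTwist B (by simp) X₀ hε x (hi ε hε (x, 0))
      fun v w => reducedIntegrand_left B hε X₀ (gaussCutoff ε u) (x, 0) v w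
  · rw [magneticIntegral_eq_reduced B (integrable_gaussCutoff_phaseExp hε X₀)
      (integrable_gaussCutoff hε (Lp.memLp u)), ← integral_prod_swap]
    exact integral_eq_partialFourier_gaussTwist B (by simp) X₀ hε X (hi ε hε X)
      fun v w => reducedIntegrand_left B hε X₀ (gaussCutoff ε u) X v w

/-- The magnetic product `u #^B 𝔢_{X₀}`. -/
theorem isMagneticProduct_phaseExp_right (B : MagneticField N) (X₀ : PhaseSpace N)
    (u : PhaseLp N) :
    IsMagneticProduct B u (phaseExp X₀)
      (partialFourierInvL (twistL B (-1) X₀ (partialFourierL N u))) := by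
  have hi : ∀ ε, 0 < ε → ∀ X, Integrable (reducedIntegrand B (gaussCutoff ε u)
      (gaussCutoff ε (phaseExp X₀)) X) ((volume : Measure (ConfSpace N)).prod volume) :=
    fun ε hε X => integrable_reducedIntegrand B (integrable_gaussCutoff hε (Lp.memLp u))
      (integrable_gaussCutoff_phaseExp hε X₀) X
  refine isMagneticProduct_of_gaussTwist B (-1) X₀ u (fun ε hε x => ?_) fun ε hε X => ?_
  · exact integrable_gaussTwist B (by simp) X₀ hε x (hi ε hε (x, 0))
      fun v w => reducedIntegrand_right B hε X₀ (gaussCutoff ε u) (x, 0) v w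
  · rw [magneticIntegral_eq_reduced B (integrable_gaussCutoff hε (Lp.memLp u))
      (integrable_gaussCutoff_phaseExp hε X₀)]
    exact integral_eq_partialFourier_gaussTwist B (by simp) X₀ hε X (hi ε hε X)
      fun v w => reducedIntegrand_right B hε X₀ (gaussCutoff ε u) X v w

theorem gaussCutoff_congr {f g : PhaseSpace N → ℂ} (h : f =ᵐ[volume] g) (ε : ℝ) :
    gaussCutoff ε f =ᵐ[volume] gaussCutoff ε g := by
  filter_upwards [h] with X hX
  rw [gaussCutoff, gaussCutoff, hX]

theorem magneticIntegral_congr_left (B : MagneticField N) {f f' : PhaseSpace N → ℂ}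
    (h : f =ᵐ[volume] f') (g : PhaseSpace N → ℂ) :
    magneticIntegral B f g = magneticIntegral B f' g := by
  ext X
  simp only [magneticIntegral]
  congr 1
  refine integral_congr_ae ?_
  filter_upwards [h] with Y hY
  rw [hY]

theorem IsMagneticProduct.congr_left {B : MagneticField N} {f f' g p : PhaseSpace N → ℂ}
    (h : IsMagneticProduct B f g p) (hf : f =ᵐ[volume] f') : IsMagneticProduct B f' g p := by
  refine ⟨h.1, h.2.congr fun ε => ?_⟩
  rw [magneticIntegral_congr_left B (gaussCutoff_congr hf ε)]

/-- Uniqueness of L² limits; measurability of the regularized products is what the triangle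
inequality for `eLpNorm` asks for. It identifies the chosen `magneticProduct` with the explicit
formula. -/
theorem IsMagneticProduct.ae_eq {B : MagneticField N} {f g p q : PhaseSpace N → ℂ}
    (hm : ∀ ε, 0 < ε → AEStronglyMeasurable
      (magneticIntegral B (gaussCutoff ε f) (gaussCutoff ε g)) volume)
    (hp : IsMagneticProduct B f g p) (hq : IsMagneticProduct B f g q) : p =ᵐ[volume] q := by
  have hle : eLpNorm (p - q) 2 volume ≤ 0 := by
    have h := hp.2.add hq.2
    rw [add_zero] at h
    refine ge_of_tendsto h ?_
    filter_upwards [self_mem_nhdsWithin] with ε hε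
    have e : p - q = (fun X => magneticIntegral B (gaussCutoff ε f) (gaussCutoff ε g) X - q X) -
        fun X => magneticIntegral B (gaussCutoff ε f) (gaussCutoff ε g) X - p X := by
      ext X
      simp
    rw [e, add_comm]
    exact eLpNorm_sub_le ((hm ε hε).sub hq.1.1) ((hm ε hε).sub hp.1.1) (by norm_num)
  have h0 := (eLpNorm_eq_zero_iff (hp.1.1.sub hq.1.1) (by norm_num)).1 (le_antisymm hle zero_le)
  filter_upwards [h0] with X hX
  exact sub_eq_zero.1 hX

end MagneticTranslations

/-! ### Plancherel on phase space. -/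

section DoubleFourier

variable {N : ℕ}

/-- The Fourier integral over phase space, with `ξ₁` dual to the second variable and `ξ₂` dual to
the first one. -/
def doubleFourier (J : PhaseSpace N → ℂ) (p : ConfSpace N × ConfSpace N) : ℂ :=
  ∫ q : PhaseSpace N, Complex.exp (Complex.I * (inner ℝ p.1 q.2 + inner ℝ p.2 q.1 : ℝ)) * J q

theorem norm_exp_I_mul_ofReal (t : ℝ) : ‖Complex.exp (Complex.I * (t : ℂ))‖ = 1 := by
  rw [mul_comm, Complex.norm_exp_ofReal_mul_I]

theorem integrable_doubleFourier {J : PhaseSpace N → ℂ} (hJ : Integrable J)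
    (p : ConfSpace N × ConfSpace N) : Integrable fun q : PhaseSpace N =>
      Complex.exp (Complex.I * (inner ℝ p.1 q.2 + inner ℝ p.2 q.1 : ℝ)) * J q :=
  hJ.bdd_mul (c := 1) (Continuous.aestronglyMeasurable (by fun_prop))
    (Eventually.of_forall fun _ => (norm_exp_I_mul_ofReal _).le)

theorem measurePreserving_swap_phaseSpace :
    MeasurePreserving (Prod.swap : PhaseSpace N → PhaseSpace N) volume volume :=
  Measure.measurePreserving_swap (μ := (volume : Measure (ConfSpace N)))
    (ν := (volume : Measure (ConfSpace N)))

theorem doubleFourier_eq {J : PhaseSpace N → ℂ} (hJ : Integrable J)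
    (p : ConfSpace N × ConfSpace N) :
    doubleFourier J p = partialFourier (fun q => partialFourier J q.swap) p := by
  rw [doubleFourier, integral_phaseSpace (integrable_doubleFourier hJ p)]
  simp only [partialFourier, angularFourier, Prod.fst_swap, Prod.snd_swap, ← integral_const_mul]
  congr 1 with a
  congr 1 with v
  rw [← mul_assoc, ← Complex.exp_add]
  push_cast
  ring_nf

theorem lintegral_enorm_doubleFourier_sq {J : PhaseSpace N → ℂ} (hJ : Integrable J)
    (hJ2 : MemLp J 2 volume) :
    ∫⁻ p, ‖doubleFourier J p‖ₑ ^ 2 =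
      ENNReal.ofReal ((2 * Real.pi) ^ (2 * N)) * ∫⁻ q, ‖J q‖ₑ ^ 2 := by
  have hfi := FiberIntegrable.of_integrable hJ
  have hm := memLp_partialFourier hJ2 hfi
  have hs : MemLp (fun q : PhaseSpace N => partialFourier J q.swap) 2 volume :=
    hm.comp_measurePreserving measurePreserving_swap_phaseSpace
  have hsi : FiberIntegrable (fun q : PhaseSpace N => partialFourier J q.swap) := by
    refine Eventually.of_forall fun v => ?_
    -- With the second frequency zero, integrating out the second variable leaves the partial
    -- transform at v, which Fubini shows to be integrable.
    have h := integrable_doubleFourier hJ (v, 0)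
    rw [Measure.volume_eq_prod] at h
    refine h.integral_prod_left.congr (Eventually.of_forall fun a => ?_)
    simp [partialFourier, angularFourier]
  have h1 : ∫⁻ q : PhaseSpace N, ‖partialFourier J q.swap‖ₑ ^ 2 =
      ∫⁻ q, ‖partialFourier J q‖ₑ ^ 2 :=
    (lintegral_map' (f := fun q : PhaseSpace N => ‖partialFourier J q‖ₑ ^ 2)
      (g := (Prod.swap : PhaseSpace N → PhaseSpace N))
      (by
        rw [measurePreserving_swap_phaseSpace.map_eq]
        exact hm.1.enorm.pow_const 2)
      measurePreserving_swap_phaseSpace.measurable.aemeasurable).symm.trans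
      (by rw [measurePreserving_swap_phaseSpace.map_eq])
  simp only [doubleFourier_eq hJ]
  refine (lintegral_enorm_partialFourier_sq hs hsi).trans ?_
  rw [h1, lintegral_enorm_partialFourier_sq hJ2 hfi, ← mul_assoc,
    ← ENNReal.ofReal_mul (by positivity), ← pow_add, ← two_mul N]

end DoubleFourier

/-! ### The norm identity for the modulation form. -/

section ModulationForm

variable {N : ℕ}

/-- The total translation in the double magnetic product `𝔢_{-X} # f # 𝔢_{X-Y}`. -/
def doubleShift (P : PhaseSpace N × PhaseSpace N) : PhaseSpace N :=
  twistShift (-1) (P.1 - P.2) + twistShift 1 (-P.1)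

/-- The total multiplier in the double magnetic product `𝔢_{-X} # f # 𝔢_{X-Y}`. -/
def doubleKernel (B : MagneticField N) (P : PhaseSpace N × PhaseSpace N) (Z : PhaseSpace N) : ℂ :=
  twistKernel B (-1) (P.1 - P.2) 0 Z 0 *
    twistKernel B 1 (-P.1) 0 (Z + twistShift (-1) (P.1 - P.2)) 0

theorem continuous_doubleShift : Continuous (doubleShift (N := N)) := by
  unfold doubleShift twistShift
  fun_prop

theorem continuous_doubleKernel (B : MagneticField N) :
    Continuous fun q : (PhaseSpace N × PhaseSpace N) × PhaseSpace N =>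
      doubleKernel B q.1 q.2 := by
  unfold doubleKernel twistKernel twistShift
  fun_prop

theorem norm_twistKernel_zero (B : MagneticField N) (s : ℝ) (X₀ P : PhaseSpace N)
    (w : ConfSpace N) : ‖twistKernel B s X₀ 0 P w‖ = 1 := by
  rw [norm_twistKernel]
  simp

theorem norm_doubleKernel (B : MagneticField N) (P : PhaseSpace N × PhaseSpace N)
    (Z : PhaseSpace N) : ‖doubleKernel B P Z‖ = 1 := by
  rw [doubleKernel, norm_mul, norm_twistKernel_zero, norm_twistKernel_zero, one_mul]

theorem twistL_twistL_ae_eq (B : MagneticField N) (P : PhaseSpace N × PhaseSpace N)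
    (F : PhaseLp N) :
    twistL B (-1) (P.1 - P.2) (twistL B 1 (-P.1) F) =ᵐ[volume]
      fun Z => doubleKernel B P Z * F (Z + doubleShift P) := by
  filter_upwards [twistL_ae_eq B (-1) (P.1 - P.2) (twistL B 1 (-P.1) F),
    (measurePreserving_add_phaseSpace (twistShift (-1) (P.1 - P.2))).quasiMeasurePreserving.ae
      (twistL_ae_eq B 1 (-P.1) F)] with Z h1 h2
  rw [h1, h2, doubleKernel, doubleShift, mul_assoc, add_assoc]

/-- The modulation map, written in terms of partial Fourier transforms. -/
def modulationForm (B : MagneticField N) (H F : PhaseLp N) (P : PhaseSpace N × PhaseSpace N) : ℂ :=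
  inner ℂ H (twistL B (-1) (P.1 - P.2) (twistL B 1 (-P.1) F))

theorem modulationForm_eq_integral (B : MagneticField N) (H F : PhaseLp N)
    (P : PhaseSpace N × PhaseSpace N) :
    modulationForm B H F P = ∫ Z, conj (H Z) * (doubleKernel B P Z * F (Z + doubleShift P)) := by
  rw [modulationForm, L2.inner_def]
  refine integral_congr_ae ?_
  filter_upwards [twistL_twistL_ae_eq B P F] with Z hZ
  rw [RCLike.inner_apply, hZ, mul_comm]

theorem stronglyMeasurable_modulationForm (B : MagneticField N) (H F : PhaseLp N) :
    StronglyMeasurable (modulationForm B H F) := by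
  have h : modulationForm B H F = fun P =>
      ∫ Z, conj (H Z) * (doubleKernel B P Z * F (Z + doubleShift P)) :=
    funext (modulationForm_eq_integral B H F)
  rw [h]
  refine StronglyMeasurable.integral_prod_right' (f := fun q : (PhaseSpace N × PhaseSpace N) ×
    PhaseSpace N => conj (H q.2) * (doubleKernel B q.1 q.2 * F (q.2 + doubleShift q.1))) ?_
  have hH : StronglyMeasurable fun q : (PhaseSpace N × PhaseSpace N) × PhaseSpace N => H q.2 :=
    (Lp.stronglyMeasurable H).comp_measurable measurable_snd
  have hF := (Lp.stronglyMeasurable F).comp_measurable (g := fun q : (PhaseSpace N × PhaseSpace N) ×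
    PhaseSpace N => q.2 + doubleShift q.1)
    (measurable_snd.add (continuous_doubleShift.measurable.comp measurable_fst))
  exact (Complex.continuous_conj.comp_stronglyMeasurable hH).mul
    ((continuous_doubleKernel B).stronglyMeasurable.mul hF)

/-- The integrand of `modulationForm` at vanishing momenta, in sheared variables. -/
def modulationDensity (B : MagneticField N) (H F : PhaseLp N) (x : ConfSpace N × ConfSpace N)
    (q : PhaseSpace N) : ℂ :=
  conj (H (q.1 + (1 / 2 : ℝ) • q.2, q.2)) *
    (doubleKernel B ((x.1, 0), (x.2, 0)) (q.1 + (1 / 2 : ℝ) • q.2, q.2) *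
      F ((q.1 + (1 / 2 : ℝ) • q.2, q.2) + doubleShift ((x.1, 0), (x.2, 0))))

theorem doubleShift_exchangeMiddle (x p : ConfSpace N × ConfSpace N) :
    doubleShift (exchangeMiddle (x, p)) = doubleShift ((x.1, 0), (x.2, 0)) := by
  simp [doubleShift, exchangeMiddle, twistShift]

theorem doubleShift_eq (x : ConfSpace N × ConfSpace N) :
    doubleShift ((x.1, 0), (x.2, 0)) = (-x.1 + (1 / 2 : ℝ) • x.2, -x.2) := by
  simp only [doubleShift, twistShift, Prod.fst_sub, Prod.fst_neg, Prod.mk_add_mk, Prod.mk.injEq]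
  exact ⟨by module, by module⟩

/-- The phase of the double multiplier that does not depend on the point of phase space. -/
def modulationPhase (x p : ConfSpace N × ConfSpace N) : ℝ :=
  (1 / 2) * inner ℝ (x.1 - x.2) (p.1 - p.2) - (1 / 2) * inner ℝ x.1 p.1

/-- The exponentials of the two twists are evaluated, up to constants, at Z₁ - Z₂/2 with momentum ξ
- η and at Z₁ + Z₂/2 with momentum -ξ. In the coordinates Z₁ = q₁ + q₂/2, Z₂ = q₂ the ξ·q₁ terms
cancel and a pure character in q is left. -/
theorem doubleKernel_exchangeMiddle (B : MagneticField N) (x p : ConfSpace N × ConfSpace N)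
    (q : PhaseSpace N) :
    doubleKernel B (exchangeMiddle (x, p)) (q.1 + (1 / 2 : ℝ) • q.2, q.2) =
      Complex.exp (Complex.I * (modulationPhase x p : ℝ)) *
        (Complex.exp (Complex.I * (inner ℝ p.1 q.2 + inner ℝ p.2 q.1 : ℝ)) *
          doubleKernel B ((x.1, 0), (x.2, 0)) (q.1 + (1 / 2 : ℝ) • q.2, q.2)) := by
  simp only [doubleKernel, exchangeMiddle, twistKernel, twistShift, Prod.fst_sub, Prod.snd_sub,
    Prod.fst_neg, Prod.snd_neg, Prod.mk_add_mk, neg_zero, sub_zero, zero_mul, Real.exp_zero,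
    Complex.ofReal_one, one_mul, inner_zero_right, Complex.ofReal_zero, mul_zero, Complex.exp_zero,
    mul_one]
  rw [mul_mul_mul_comm, ← Complex.exp_add, mul_comm,
    ← mul_assoc (Complex.exp _) (Complex.exp _), ← Complex.exp_add]
  congr 2
  rw [← mul_add, ← mul_add, neg_mul, ← mul_neg]
  congr 1
  rw [← Complex.ofReal_add, ← Complex.ofReal_neg, ← Complex.ofReal_add]
  congr 1
  simp only [modulationPhase, inner_add_left, inner_sub_left, inner_sub_right, inner_neg_right,
    real_inner_smul_left, inner_neg_left, real_inner_comm _ q.2,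
    real_inner_comm _ q.1]
  ring

theorem measurePreserving_shearFst :
    MeasurePreserving (fun q : PhaseSpace N => (q.1 + (1 / 2 : ℝ) • q.2, q.2)) volume volume := by
  have h : MeasurePreserving (fun q : ConfSpace N × ConfSpace N => (q.1, q.2 + (1 / 2 : ℝ) • q.1))
      ((volume : Measure (ConfSpace N)).prod volume) (volume.prod volume) :=
    (MeasurePreserving.id volume).skew_product (g := fun w P => P + (1 / 2 : ℝ) • w)
      (by fun_prop) (Eventually.of_forall fun w => map_add_right_eq_self _ _)
  exact measurePreserving_swap_phaseSpace.comp (h.comp measurePreserving_swap_phaseSpace)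

theorem integrable_modulation (B : MagneticField N) (H F : PhaseLp N)
    (P : PhaseSpace N × PhaseSpace N) :
    Integrable fun Z => conj (H Z) * (doubleKernel B P Z * F (Z + doubleShift P)) := by
  refine ((L2.integrable_inner (𝕜 := ℂ) H
    (twistL B (-1) (P.1 - P.2) (twistL B 1 (-P.1) F)))).congr ?_
  filter_upwards [twistL_twistL_ae_eq B P F] with Z hZ
  rw [RCLike.inner_apply, hZ, mul_comm]

theorem integrable_modulationDensity (B : MagneticField N) (H F : PhaseLp N)
    (x : ConfSpace N × ConfSpace N) : Integrable (modulationDensity B H F x) :=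
  measurePreserving_shearFst.integrable_comp_of_integrable
    (integrable_modulation B H F ((x.1, 0), (x.2, 0)))

theorem modulationForm_exchangeMiddle (B : MagneticField N) (H F : PhaseLp N)
    (x p : ConfSpace N × ConfSpace N) :
    modulationForm B H F (exchangeMiddle (x, p)) =
      Complex.exp (Complex.I * (modulationPhase x p : ℝ)) *
        doubleFourier (modulationDensity B H F x) p := by
  rw [modulationForm_eq_integral]
  have h := integral_map (μ := (volume : Measure (PhaseSpace N)))
    (measurePreserving_shearFst (N := N)).measurable.aemeasurable
    (f := fun Z => conj (H Z) * (doubleKernel B (exchangeMiddle (x, p)) Z *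
      F (Z + doubleShift (exchangeMiddle (x, p))))) (by
      rw [measurePreserving_shearFst.map_eq]
      exact (integrable_modulation B H F (exchangeMiddle (x, p))).1)
  rw [measurePreserving_shearFst.map_eq] at h
  rw [h, doubleFourier, ← integral_const_mul]
  congr 1 with q
  rw [doubleKernel_exchangeMiddle, doubleShift_exchangeMiddle, modulationDensity]
  ring

/-- By `doubleShift_eq` the shift is (-x + y/2, -y), a linear map of (x, y) of determinant ±1, here
written as a composition of reflections and a shear. -/
theorem measurePreserving_modulationShift (c : PhaseSpace N) :
    MeasurePreserving (fun x : ConfSpace N × ConfSpace N =>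
      c + doubleShift ((x.1, 0), (x.2, 0))) volume volume := by
  have h := (measurePreserving_add_phaseSpace c).comp
    (((Measure.measurePreserving_neg (volume : Measure (ConfSpace N))).prod
      (Measure.measurePreserving_neg (volume : Measure (ConfSpace N)))).comp
      ((measurePreserving_reflectSnd (N := N)).comp ((measurePreserving_shearFst (N := N)).comp
        (measurePreserving_reflectSnd (N := N)))))
  convert h using 1
  ext x : 1
  rw [doubleShift_eq]
  simp only [Function.comp, reflectSnd, Prod.map]
  rw [add_comm]
  congr 2
  · module
  · simp

/-- The multiplier has modulus one. Integrating first over the shift gives the square norm of F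
independently of q; what is left is that of H. -/
theorem lintegral_modulationDensity (B : MagneticField N) (H F : PhaseLp N) :
    ∫⁻ x : ConfSpace N × ConfSpace N, ∫⁻ q, ‖modulationDensity B H F x q‖ₑ ^ 2 =
      (∫⁻ Z, ‖H Z‖ₑ ^ 2) * ∫⁻ Z, ‖F Z‖ₑ ^ 2 := by
  have hH : Measurable fun Z => ‖H Z‖ₑ ^ 2 :=
    (Lp.stronglyMeasurable H).enorm.pow_const 2
  have hF : Measurable fun Z => ‖F Z‖ₑ ^ 2 :=
    (Lp.stronglyMeasurable F).enorm.pow_const 2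
  have hsh := measurePreserving_shearFst (N := N)
  have h1 : ∀ x q, ‖modulationDensity B H F x q‖ₑ ^ 2 =
      ‖H (q.1 + (1 / 2 : ℝ) • q.2, q.2)‖ₑ ^ 2 *
        ‖F ((q.1 + (1 / 2 : ℝ) • q.2, q.2) + doubleShift ((x.1, 0), (x.2, 0)))‖ₑ ^ 2 := by
    intro x q
    have hk : ‖doubleKernel B ((x.1, 0), (x.2, 0)) (q.1 + (1 / 2 : ℝ) • q.2, q.2)‖ₑ = 1 := by
      rw [← ofReal_norm, norm_doubleKernel, ENNReal.ofReal_one]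
    rw [modulationDensity, enorm_mul, enorm_mul, hk, one_mul, mul_pow, RCLike.enorm_conj]
  simp only [h1]
  rw [lintegral_lintegral_swap]
  · have h2 : ∀ q : PhaseSpace N, ∫⁻ x : ConfSpace N × ConfSpace N,
        ‖H (q.1 + (1 / 2 : ℝ) • q.2, q.2)‖ₑ ^ 2 *
          ‖F ((q.1 + (1 / 2 : ℝ) • q.2, q.2) + doubleShift ((x.1, 0), (x.2, 0)))‖ₑ ^ 2 =
        ‖H (q.1 + (1 / 2 : ℝ) • q.2, q.2)‖ₑ ^ 2 * ∫⁻ Z, ‖F Z‖ₑ ^ 2 := by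
      intro q
      have hm := measurePreserving_modulationShift (q.1 + (1 / 2 : ℝ) • q.2, q.2)
      have hFm : Measurable fun x : ConfSpace N × ConfSpace N => ‖F ((q.1 + (1 / 2 : ℝ) • q.2, q.2) +
          doubleShift ((x.1, 0), (x.2, 0)))‖ₑ ^ 2 := hF.comp hm.measurable
      rw [lintegral_const_mul _ hFm, hm.lintegral_comp hF]
    simp only [h2]
    have hHm : Measurable fun q : PhaseSpace N => ‖H (q.1 + (1 / 2 : ℝ) • q.2, q.2)‖ₑ ^ 2 :=
      hH.comp hsh.measurable
    rw [lintegral_mul_const _ hHm, hsh.lintegral_comp hH]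
  · refine Measurable.aemeasurable ?_
    have m1 : Measurable fun q : (ConfSpace N × ConfSpace N) × PhaseSpace N =>
        ((q.2.1 + (1 / 2 : ℝ) • q.2.2, q.2.2) : PhaseSpace N) := by fun_prop
    have m2 : Measurable fun q : (ConfSpace N × ConfSpace N) × PhaseSpace N =>
        doubleShift (((q.1.1, 0), (q.1.2, 0)) : PhaseSpace N × PhaseSpace N) :=
      continuous_doubleShift.measurable.comp (by fun_prop)
    exact (hH.comp m1).mul (hF.comp (m1.add m2))

/-- At fixed positions the form is a phase times `doubleFourier` of the density, so Plancherel over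
the momenta applies wherever the density is square integrable. By `lintegral_modulationDensity` this
holds for almost all positions. -/
theorem lintegral_enorm_modulationForm_sq (B : MagneticField N) (H F : PhaseLp N) :
    ∫⁻ P, ‖modulationForm B H F P‖ₑ ^ 2 =
      ENNReal.ofReal ((2 * Real.pi) ^ (2 * N)) * ((∫⁻ Z, ‖H Z‖ₑ ^ 2) * ∫⁻ Z, ‖F Z‖ₑ ^ 2) := by
  have hb : Measurable fun P => ‖modulationForm B H F P‖ₑ ^ 2 :=
    (stronglyMeasurable_modulationForm B H F).enorm.pow_const 2
  have hfin : ∀ G : PhaseLp N, ∫⁻ Z, ‖G Z‖ₑ ^ 2 < ⊤ := fun G =>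
    (memLp_two_iff_lintegral (Lp.aestronglyMeasurable G)).1 (Lp.memLp G)
  have hd := lintegral_modulationDensity B H F
  have hmeas : AEMeasurable (fun x : ConfSpace N × ConfSpace N =>
      ∫⁻ q, ‖modulationDensity B H F x q‖ₑ ^ 2) volume := by
    refine Measurable.aemeasurable (Measurable.lintegral_prod_right'
      (f := fun q : (ConfSpace N × ConfSpace N) × PhaseSpace N =>
        ‖modulationDensity B H F q.1 q.2‖ₑ ^ 2) ?_)
    have m1 : Measurable fun q : (ConfSpace N × ConfSpace N) × PhaseSpace N =>
        ((q.2.1 + (1 / 2 : ℝ) • q.2.2, q.2.2) : PhaseSpace N) := by fun_prop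
    have m2 : Measurable fun q : (ConfSpace N × ConfSpace N) × PhaseSpace N =>
        (((q.1.1, 0), (q.1.2, 0)) : PhaseSpace N × PhaseSpace N) := by fun_prop
    have mH := (Lp.stronglyMeasurable H).comp_measurable m1
    have mF := (Lp.stronglyMeasurable F).comp_measurable
      (m1.add (continuous_doubleShift.measurable.comp m2))
    have mK := (continuous_doubleKernel B).stronglyMeasurable.comp_measurable (m2.prodMk m1)
    exact ((Complex.continuous_conj.comp_stronglyMeasurable mH).mul (mK.mul mF)).enorm.pow_const 2
  have hae : ∀ᵐ x : ConfSpace N × ConfSpace N,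
      ∫⁻ q, ‖modulationDensity B H F x q‖ₑ ^ 2 < ⊤ := by
    refine ae_lt_top' hmeas ?_
    rw [hd]
    exact (ENNReal.mul_lt_top (hfin H) (hfin F)).ne
  have h1 : ∫⁻ P, ‖modulationForm B H F P‖ₑ ^ 2 =
      ∫⁻ x : ConfSpace N × ConfSpace N, ∫⁻ p : ConfSpace N × ConfSpace N,
        ‖modulationForm B H F (exchangeMiddle (x, p))‖ₑ ^ 2 := by
    have h := (measurePreserving_exchangeMiddle (N := N)).lintegral_comp hb
    have hbm : Measurable fun q : (ConfSpace N × ConfSpace N) × (ConfSpace N × ConfSpace N) =>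
        ‖modulationForm B H F (exchangeMiddle q)‖ₑ ^ 2 :=
      hb.comp measurePreserving_exchangeMiddle.measurable
    rw [lintegral_prod _ hbm.aemeasurable] at h
    exact h.symm
  rw [h1, ← hd, ← lintegral_const_mul'' _ hmeas]
  refine lintegral_congr_ae ?_
  filter_upwards [hae] with x hx
  have hi := integrable_modulationDensity B H F x
  rw [← lintegral_enorm_doubleFourier_sq hi ((memLp_two_iff_lintegral hi.1).2 hx)]
  refine lintegral_congr fun p => ?_
  rw [modulationForm_exchangeMiddle, enorm_mul, ← ofReal_norm (Complex.exp _),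
    norm_exp_I_mul_ofReal, ENNReal.ofReal_one, one_mul]

end ModulationForm

/-! ### The modulation map: orthogonality relations and isometry. -/

section ModulationMap

variable {N : ℕ}

theorem aestronglyMeasurable_magneticIntegral (B : MagneticField N) {f g : PhaseSpace N → ℂ}
    (hf : Integrable f) (hg : Integrable g) :
    AEStronglyMeasurable (magneticIntegral B f g) volume := by
  have h : magneticIntegral B f g = fun X => ((Real.pi : ℂ) ^ (2 * N))⁻¹ *
      ∫ Q, compositionIntegrand B f g X Q
        ∂((volume : Measure (PhaseSpace N)).prod (volume : Measure (PhaseSpace N))) := by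
    ext X
    rw [integral_prod _ (integrable_compositionIntegrand B hf hg X)]
    rfl
  rw [h]
  refine AEStronglyMeasurable.const_mul ?_ _
  refine AEStronglyMeasurable.integral_prod_right'
    (f := fun q : PhaseSpace N × (PhaseSpace N × PhaseSpace N) =>
      compositionIntegrand B f g q.1 q.2) ?_
  have hfg : AEStronglyMeasurable (fun q : PhaseSpace N × (PhaseSpace N × PhaseSpace N) =>
      f q.2.1 * g q.2.2) ((volume : Measure (PhaseSpace N)).prod (volume.prod volume)) :=
    (hf.mul_prod hg).1.comp_snd
  refine AEStronglyMeasurable.congr (AEStronglyMeasurable.mul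
    (f := fun q : PhaseSpace N × (PhaseSpace N × PhaseSpace N) =>
      Complex.exp (-2 * Complex.I * (sympl (q.1 - q.2.1) (q.1 - q.2.2) : ℂ)) *
      magneticPhase B (q.1.1 - q.2.1.1 + q.2.2.1) (q.2.1.1 - q.2.2.1 + q.1.1)
        (q.2.2.1 - q.1.1 + q.2.1.1))
    (Continuous.aestronglyMeasurable (by unfold sympl; fun_prop)) hfg)
    (Eventually.of_forall fun q => ?_)
  simp only [compositionIntegrand, Pi.mul_apply]
  ring

theorem isMagneticProduct_magneticProduct {B : MagneticField N} {f g p : PhaseSpace N → ℂ}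
    (h : IsMagneticProduct B f g p) : IsMagneticProduct B f g (magneticProduct B f g) := by
  have h' : ∃ p, IsMagneticProduct B f g p := ⟨p, h⟩
  rw [magneticProduct, dif_pos h']
  exact h'.choose_spec

theorem isMagneticProduct_single (B : MagneticField N) (X : PhaseSpace N) (f : PhaseLp N) :
    IsMagneticProduct B (phaseExp X) f (magneticProduct B (phaseExp X) f) :=
  isMagneticProduct_magneticProduct (isMagneticProduct_phaseExp_left B X f)

theorem magneticProduct_single_ae_eq (B : MagneticField N) (X : PhaseSpace N) (f : PhaseLp N) :
    magneticProduct B (phaseExp X) f =ᵐ[volume]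
      partialFourierInvL (twistL B 1 X (partialFourierL N f)) :=
  IsMagneticProduct.ae_eq (fun _ hε => aestronglyMeasurable_magneticIntegral B
    (integrable_gaussCutoff_phaseExp hε X) (integrable_gaussCutoff hε (Lp.memLp f)))
    (isMagneticProduct_single B X f) (isMagneticProduct_phaseExp_left B X f)

theorem isMagneticProduct_double_explicit (B : MagneticField N) (X X' : PhaseSpace N)
    (f : PhaseLp N) :
    IsMagneticProduct B (magneticProduct B (phaseExp X) f) (phaseExp X')
      (partialFourierInvL (twistL B (-1) X' (twistL B 1 X (partialFourierL N f)))) := by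
  have h := isMagneticProduct_phaseExp_right B X'
    (partialFourierInvL (twistL B 1 X (partialFourierL N f)))
  rw [partialFourierL_partialFourierInvL] at h
  exact h.congr_left (magneticProduct_single_ae_eq B X f).symm

theorem isMagneticProduct_double (B : MagneticField N) (X X' : PhaseSpace N) (f : PhaseLp N) :
    IsMagneticProduct B (magneticProduct B (phaseExp X) f) (phaseExp X')
      (magneticProduct B (magneticProduct B (phaseExp X) f) (phaseExp X')) :=
  isMagneticProduct_magneticProduct (isMagneticProduct_double_explicit B X X' f)

theorem magneticProduct_double_ae_eq (B : MagneticField N) (X X' : PhaseSpace N)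
    (f : PhaseLp N) :
    magneticProduct B (magneticProduct B (phaseExp X) f) (phaseExp X') =ᵐ[volume]
      partialFourierInvL (twistL B (-1) X' (twistL B 1 X (partialFourierL N f))) :=
  IsMagneticProduct.ae_eq (fun _ hε => aestronglyMeasurable_magneticIntegral B
    (integrable_gaussCutoff hε (isMagneticProduct_single B X f).1)
    (integrable_gaussCutoff_phaseExp hε X'))
    (isMagneticProduct_double B X X' f) (isMagneticProduct_double_explicit B X X' f)

theorem norm_star_phaseLp (h : PhaseLp N) : ‖star h‖ = ‖h‖ := by
  rw [Lp.norm_def, Lp.norm_def]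
  congr 1
  refine eLpNorm_congr_norm_ae ?_
  filter_upwards [Lp.coeFn_star h] with Z hZ
  rw [hZ, Pi.star_apply, norm_star]

/-- The intermediate inverse transform cancels against the next direct one. The bilinear pairing
with h is the inner product with its conjugate, and the last inverse transform is moved to that side
at the cost of (2π)^(-N). -/
theorem modulationMap_eq (B : MagneticField N) (h f : PhaseLp N)
    (P : PhaseSpace N × PhaseSpace N) :
    modulationMap B h f P = ((((2 * Real.pi) ^ N)⁻¹ : ℝ) : ℂ) *
      modulationForm B (partialFourierL N (star h)) (partialFourierL N f) P := by
  rw [modulationForm, ← inner_partialFourierInvL, modulationMap, realPairing, L2.inner_def]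
  refine integral_congr_ae ?_
  filter_upwards [magneticProduct_double_ae_eq B (-P.1) (P.1 - P.2) f, Lp.coeFn_star h]
    with Z h1 h2
  rw [h1, h2, RCLike.inner_apply, Pi.star_apply, RCLike.star_def, RCLike.conj_conj]

theorem twistL_add (B : MagneticField N) (s : ℝ) (X₀ : PhaseSpace N) (F G : PhaseLp N) :
    twistL B s X₀ (F + G) = twistL B s X₀ F + twistL B s X₀ G := by
  apply Lp.ext
  filter_upwards [twistL_ae_eq B s X₀ (F + G), twistL_ae_eq B s X₀ F, twistL_ae_eq B s X₀ G,
    Lp.coeFn_add (twistL B s X₀ F) (twistL B s X₀ G),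
    (measurePreserving_add_phaseSpace (twistShift s X₀)).quasiMeasurePreserving.ae
      (Lp.coeFn_add F G)] with P h1 h2 h3 h4 h5
  rw [h1, h4, Pi.add_apply, h2, h3, h5, Pi.add_apply, mul_add]

theorem twistL_smul (B : MagneticField N) (s : ℝ) (X₀ : PhaseSpace N) (c : ℂ) (F : PhaseLp N) :
    twistL B s X₀ (c • F) = c • twistL B s X₀ F := by
  apply Lp.ext
  filter_upwards [twistL_ae_eq B s X₀ (c • F), twistL_ae_eq B s X₀ F,
    Lp.coeFn_smul c (twistL B s X₀ F),
    (measurePreserving_add_phaseSpace (twistShift s X₀)).quasiMeasurePreserving.ae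
      (Lp.coeFn_smul c F)] with P h1 h2 h3 h4
  rw [h1, h3, Pi.smul_apply, h2, h4, Pi.smul_apply, smul_eq_mul, smul_eq_mul, mul_left_comm]

theorem eLpNorm_modulationForm (B : MagneticField N) (H F : PhaseLp N) :
    eLpNorm (modulationForm B H F) 2 volume =
      ENNReal.ofReal ((2 * Real.pi) ^ N * (‖H‖ * ‖F‖)) := by
  have h := lintegral_enorm_modulationForm_sq B H F
  have key : ∀ G : PhaseLp N, ∫⁻ Z, ‖G Z‖ₑ ^ 2 = ENNReal.ofReal ‖G‖ ^ 2 := fun G => by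
    rw [ofReal_norm, Lp.enorm_def, eLpNorm_two_sq]
  rw [← eLpNorm_two_sq, key, key, ← mul_pow, pow_mul', ENNReal.ofReal_pow (by positivity),
    ← mul_pow] at h
  rw [(ENNReal.pow_right_strictMono two_ne_zero).injective h, ENNReal.ofReal_mul (by positivity),
    ENNReal.ofReal_mul (by positivity)]

theorem memLp_modulationForm (B : MagneticField N) (H F : PhaseLp N) :
    MemLp (modulationForm B H F) 2 volume :=
  ⟨(stronglyMeasurable_modulationForm B H F).aestronglyMeasurable, by
    rw [eLpNorm_modulationForm]
    exact ENNReal.ofReal_lt_top⟩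

/-- `modulationForm` as a sesquilinear map into `L²(Ξ × Ξ)`. -/
def modulationL (B : MagneticField N) : PhaseLp N →ₗ⋆[ℂ] PhaseLp N →ₗ[ℂ]
    Lp ℂ 2 (volume : Measure (PhaseSpace N × PhaseSpace N)) :=
  LinearMap.mk₂'ₛₗ (starRingEnd ℂ) (RingHom.id ℂ) (fun H F => (memLp_modulationForm B H F).toLp _)
    (fun H H' F => by
      rw [← MemLp.toLp_add, MemLp.toLp_eq_toLp_iff]
      exact Eventually.of_forall fun P => inner_add_left _ _ _)
    (fun c H F => by
      rw [← MemLp.toLp_const_smul, MemLp.toLp_eq_toLp_iff]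
      exact Eventually.of_forall fun P => inner_smul_left _ _ _)
    (fun H F F' => by
      rw [← MemLp.toLp_add, MemLp.toLp_eq_toLp_iff]
      refine Eventually.of_forall fun P => ?_
      simp only [modulationForm, twistL_add, inner_add_right, Pi.add_apply])
    (fun c H F => by
      rw [RingHom.id_apply, ← MemLp.toLp_const_smul, MemLp.toLp_eq_toLp_iff]
      refine Eventually.of_forall fun P => ?_
      simp only [modulationForm, twistL_smul, inner_smul_right, Pi.smul_apply, smul_eq_mul])

theorem modulationL_ae_eq (B : MagneticField N) (H F : PhaseLp N) :
    modulationL B H F =ᵐ[volume] modulationForm B H F :=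
  MemLp.coeFn_toLp (memLp_modulationForm B H F)

theorem norm_modulationL (B : MagneticField N) (H F : PhaseLp N) :
    ‖modulationL B H F‖ = (2 * Real.pi) ^ N * ‖H‖ * ‖F‖ := by
  have h : ‖modulationL B H F‖ = (eLpNorm (modulationForm B H F) 2 volume).toReal :=
    Lp.norm_toLp _ (memLp_modulationForm B H F)
  rw [h, eLpNorm_modulationForm, ENNReal.toReal_ofReal (by positivity), mul_assoc]

/-- Polarization twice: in the linear argument for fixed h, then in the conjugate-linear one.
Conjugate linearity is why k and h appear exchanged on the right. -/
theorem inner_of_norm_eq_mul_norm {H K : Type*} [NormedAddCommGroup H] [InnerProductSpace ℂ H]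
    [NormedAddCommGroup K] [InnerProductSpace ℂ K] {c : ℝ} (b : H →ₗ⋆[ℂ] H →ₗ[ℂ] K)
    (hb : ∀ h f, ‖b h f‖ = c * ‖h‖ * ‖f‖) (h k f g : H) :
    inner ℂ (b h f) (b k g) = (c ^ 2 : ℝ) * (inner ℂ k h * inner ℂ f g) := by
  have hd : ∀ h, inner ℂ (b h f) (b h g) = ((c ^ 2 : ℝ) : ℂ) * (inner ℂ h h * inner ℂ f g) := by
    intro h
    rw [inner_eq_of_norm_eq (b h) (hb h), inner_self_eq_norm_sq_to_K]
    have e : (RCLike.ofReal ‖h‖ : ℂ) = Complex.ofReal ‖h‖ := rfl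
    rw [e]
    push_cast
    ring
  have h1 := hd (h + k)
  have h2 := hd (h + Complex.I • k)
  have hh := hd h
  have hk := hd k
  simp only [map_add, LinearMap.map_smulₛₗ, LinearMap.add_apply, LinearMap.smul_apply,
    inner_add_left, inner_add_right, inner_smul_left, inner_smul_right, Complex.conj_I, map_neg,
    neg_neg] at h1 h2
  -- The identity at h + k gives the sum of the two cross terms, and i times that at h + ik their
  -- difference; `hh` and `hk` remove the diagonal terms, and the last summand only uses i² = -1.
  linear_combination (1 / 2 : ℂ) * h1 + (Complex.I / 2) * h2 - (1 / 2 + Complex.I / 2) * hh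
    - (1 / 2 + Complex.I / 2) * hk
    + (1 / 2 : ℂ) * (inner ℂ (b h f) (b k g) - inner ℂ (b k f) (b h g)
      - ((c ^ 2 : ℝ) : ℂ) * (inner ℂ k h - inner ℂ h k + Complex.I * inner ℂ k k) * inner ℂ f g
      + Complex.I * inner ℂ (b k f) (b k g)) * Complex.I_sq

theorem inner_modulationL (B : MagneticField N) (H K F G : PhaseLp N) :
    inner ℂ (modulationL B H F) (modulationL B K G) =
      ((((2 * Real.pi) ^ N) ^ 2 : ℝ) : ℂ) * (inner ℂ K H * inner ℂ F G) :=
  inner_of_norm_eq_mul_norm (modulationL B) (norm_modulationL B) H K F G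

theorem memLp_modulationMap (B : MagneticField N) (h f : PhaseLp N) :
    MemLp (modulationMap B h f) 2 volume := by
  have e : modulationMap B h f = fun P => ((((2 * Real.pi) ^ N)⁻¹ : ℝ) : ℂ) *
      modulationForm B (partialFourierL N (star h)) (partialFourierL N f) P :=
    funext (modulationMap_eq B h f)
  rw [e]
  exact (memLp_modulationForm B _ _).const_mul _

theorem realPairing_conj_eq_inner (f g : PhaseLp N) :
    realPairing (fun Z => conj (f Z)) g = inner ℂ f g := by
  rw [realPairing, L2.inner_def]
  simp only [RCLike.inner_apply, mul_comm]

theorem inner_star_star (h k : PhaseLp N) : inner ℂ (star k) (star h) = inner ℂ h k := by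
  rw [L2.inner_def, L2.inner_def]
  refine integral_congr_ae ?_
  filter_upwards [Lp.coeFn_star h, Lp.coeFn_star k] with Z h1 h2
  rw [h1, h2, RCLike.inner_apply, RCLike.inner_apply, Pi.star_apply, Pi.star_apply,
    RCLike.star_def, RCLike.conj_conj, mul_comm]

theorem realPairing_modulationMap (B : MagneticField N) (f g h k : PhaseLp N) :
    realPairing (fun P => conj (modulationMap B h f P)) (modulationMap B k g) =
      ((2 * Real.pi) ^ (2 * N) : ℝ) *
        (realPairing (fun Z => conj (h Z)) k * realPairing (fun Z => conj (f Z)) g) := by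
  rw [realPairing_conj_eq_inner, realPairing_conj_eq_inner]
  have h1 := inner_modulationL B (partialFourierL N (star h)) (partialFourierL N (star k))
    (partialFourierL N f) (partialFourierL N g)
  rw [inner_partialFourierL, inner_partialFourierL, inner_star_star, L2.inner_def] at h1
  have h2 : realPairing (fun P => conj (modulationMap B h f P)) (modulationMap B k g) =
      ((((2 * Real.pi) ^ N)⁻¹ ^ 2 : ℝ) : ℂ) *
        ∫ P, inner ℂ (modulationL B (partialFourierL N (star h)) (partialFourierL N f) P)
          (modulationL B (partialFourierL N (star k)) (partialFourierL N g) P) := by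
    rw [realPairing, ← integral_const_mul]
    refine integral_congr_ae ?_
    filter_upwards [modulationL_ae_eq B (partialFourierL N (star h)) (partialFourierL N f),
      modulationL_ae_eq B (partialFourierL N (star k)) (partialFourierL N g)] with P e1 e2
    rw [e1, e2, RCLike.inner_apply, modulationMap_eq, modulationMap_eq, map_mul,
      Complex.conj_ofReal]
    push_cast
    ring
  rw [h2, h1]
  -- The squared inversion constant cancels the constant of the form. The factor (2π)^(2N) that
  -- survives comes from the two inner products of partial transforms, (2π)^N each.
  have hp : ((((2 * Real.pi) ^ N)⁻¹ ^ 2 : ℝ) : ℂ) * ((((2 * Real.pi) ^ N) ^ 2 : ℝ) : ℂ) = 1 := by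
    rw [← Complex.ofReal_mul, ← mul_pow, inv_mul_cancel₀ (by positivity), one_pow,
      Complex.ofReal_one]
  rw [← mul_assoc, hp, one_mul, pow_mul', sq, Complex.ofReal_mul]
  ring

/-- The normalized modulation map as a linear isometry. -/
def modulationIsometry (B : MagneticField N) (h : PhaseLp N) (hh : h ≠ 0) :
    PhaseLp N →ₗᵢ[ℂ] Lp ℂ 2 (volume : Measure (PhaseSpace N × PhaseSpace N)) where
  toLinearMap := (((((2 * Real.pi) ^ N * ‖h‖)⁻¹ * ((2 * Real.pi) ^ N)⁻¹ : ℝ)) : ℂ) •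
    (modulationL B (partialFourierL N (star h))).comp (partialFourierL N).toLinearMap
  norm_map' f := by
    have hn : ‖h‖ ≠ 0 := norm_ne_zero_iff.2 hh
    have hp : (2 * Real.pi) ^ N ≠ 0 := by positivity
    have h3 : ‖modulationL B (partialFourierL N (star h)) (partialFourierL N f)‖ =
        (2 * Real.pi) ^ N * ((2 * Real.pi) ^ N * (‖h‖ * ‖f‖)) := by
      rw [norm_modulationL, norm_partialFourierL, norm_partialFourierL, norm_star_phaseLp]
      -- The inner power on the right-hand side is the product of the two constants `fourierConst N`
      -- contributed by h and f.
      nth_rewrite 3 [← fourierConst_sq]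
      ring
    rw [LinearMap.smul_apply, norm_smul, Complex.norm_real, Real.norm_of_nonneg (by positivity)]
    refine (congrArg _ h3).trans ?_
    field_simp

theorem modulationIsometry_ae_eq (B : MagneticField N) (h : PhaseLp N) (hh : h ≠ 0)
    (f : PhaseLp N) : modulationIsometry B h hh f =ᵐ[volume] fun P =>
      ((((2 * Real.pi) ^ N * ‖h‖)⁻¹ : ℝ) : ℂ) * modulationMap B h f P := by
  refine (Lp.coeFn_smul _ (modulationL B (partialFourierL N (star h))
    (partialFourierL N f))).trans ?_
  filter_upwards [modulationL_ae_eq B (partialFourierL N (star h)) (partialFourierL N f)] with P e1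
  rw [Pi.smul_apply, e1, modulationMap_eq, smul_eq_mul, Complex.ofReal_mul, mul_assoc]

end ModulationMap

end
theorem theorem2p2 (N : ℕ) (B : MagneticField N) :
    -- the products defining the modulation mapping exist in `L²(Ξ)`
    (∀ (f : Lp ℂ 2 (volume : Measure (PhaseSpace N))) (X Y : PhaseSpace N),
      IsMagneticProduct B (phaseExp (-X)) f (magneticProduct B (phaseExp (-X)) f) ∧
      IsMagneticProduct B (magneticProduct B (phaseExp (-X)) f) (phaseExp (X - Y))
        (magneticProduct B (magneticProduct B (phaseExp (-X)) f) (phaseExp (X - Y)))) ∧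
    -- `M^B_h` maps `L²(Ξ)` into `L²(Ξ × Ξ)`
    (∀ h f : Lp ℂ 2 (volume : Measure (PhaseSpace N)),
      MemLp (modulationMap B h f) 2 (volume : Measure (PhaseSpace N × PhaseSpace N))) ∧
    -- the orthogonality relations
    (∀ f g h k : Lp ℂ 2 (volume : Measure (PhaseSpace N)),
      realPairing (fun P => conj (modulationMap B h f P)) (modulationMap B k g) =
        ((2 * Real.pi) ^ (2 * N) : ℝ) *
          (realPairing (fun Z => conj (h Z)) k * realPairing (fun Z => conj (f Z)) g)) ∧
    -- the normalized modulation mapping is a linear isometry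
    (∀ h : Lp ℂ 2 (volume : Measure (PhaseSpace N)), h ≠ 0 →
      ∃ T : Lp ℂ 2 (volume : Measure (PhaseSpace N)) →ₗᵢ[ℂ]
          Lp ℂ 2 (volume : Measure (PhaseSpace N × PhaseSpace N)),
        ∀ f, T f =ᵐ[volume] fun P =>
          ((((2 * Real.pi) ^ N * ‖h‖)⁻¹ : ℝ) : ℂ) * modulationMap B h f P) :=
  ⟨fun f X Y => ⟨isMagneticProduct_single B (-X) f, isMagneticProduct_double B (-X) (X - Y) f⟩,
    memLp_modulationMap B, realPairing_modulationMap B,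
    fun h hh => ⟨modulationIsometry B h hh, modulationIsometry_ae_eq B h hh⟩⟩
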